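/- For a linear order $D$, a \emph{point} is an element of $D$ and an \emph{interval} is a pair $[a,b]$ of points with $a<b$. Let $\mathfrak R^+$ be the set of the following 14 relations. Between points: $<$ and $=_p$ (equality of points). Between an interval $[a,b]$ and a point $c$: $\mathrm{ip}_0$ ($c<a$), $\mathrm{ip}_1$ ($c=a$), $\mathrm{ip}_2$ ($a<c<b$), $\mathrm{ip}_3$ ($c=b$), $\mathrm{ip}_4$ ($b<c$). Between an interval $[a,b]$ and an interval $[c,d]$: $=_i$ (equality of intervals), $\mathrm{ii}_{34}$ ($b=c$), $\mathrm{ii}_{14}$ ($a=c$, $b<d$), $\mathrm{ii}_{03}$ ($c<a$, $b=d$), $\mathrm{ii}_{04}$ ($c<a$, $b<d$), $\mathrm{ii}_{24}$ ($a<c<b<d$), $\mathrm{ii}_{44}$ ($b<c$). For $S\subseteq\mathfrak R^+$ let $FO+S$ be the two-sorted (points and intervals) first-order language without built-in equality whose relation symbols are those in $S$, interpreted over a linear order $D$ in the two-sorted structure consisting of the points and all intervals of $D$. For a class $C$ of linear orders, $FO+S$ \emph{defines} $r\in\mathfrak R^+$ over $C$ if there is one $FO+S$-formula $\varphi(x,y)$,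 with variables of the sorts of $r$, such that $\varphi(x,y)\leftrightarrow r(x,y)$ is valid over every $D\in C$. A set $S\subseteq\mathfrak R^+$ is \emph{$\mathfrak R^+$-complete} over $C$ if $FO+S$ defines every $r\in\mathfrak R^+$ over $C$, and \emph{$\mathfrak R^+$-incomplete} over $C$ otherwise; it is \emph{minimally $\mathfrak R^+$-complete} if it is $\mathfrak R^+$-complete and all its proper subsets are $\mathfrak R^+$-incomplete, and \emph{maximally $\mathfrak R^+$-incomplete} if it is $\mathfrak R^+$-incomplete and all its proper supersets within $\mathfrak R^+$ are $\mathfrak R^+$-complete. Theorem. 1. Over the class of all dense linear orders (those with a point strictly between any two distinct points; endpoints are allowed), the minimally $\mathfrak R^+$-complete sets are exactly the following 29 sets: $\{\mathrm{ip}_0, \mathrm{ip}_2\}$, $\{\mathrm{ip}_0, \mathrm{ip}_3\}$, $\{\mathrm{ip}_0, \mathrm{ip}_4\}$, $\{\mathrm{ip}_0, \mathrm{ii}_{24}\}$, $\{\mathrm{ip}_0, \mathrm{ii}_{03}\}$, $\{\mathrm{ip}_0, \mathrm{ii}_{34}\}$, $\{\mathrm{ip}_0, \mathrm{ii}_{04}\}$,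 $\{\mathrm{ip}_0, \mathrm{ii}_{44}\}$, $\{\mathrm{ip}_1, \mathrm{ip}_2\}$, $\{\mathrm{ip}_1, \mathrm{ip}_3\}$, $\{\mathrm{ip}_1, \mathrm{ip}_4\}$, $\{\mathrm{ip}_1, \mathrm{ii}_{24}\}$, $\{\mathrm{ip}_1, \mathrm{ii}_{03}\}$, $\{\mathrm{ip}_1, \mathrm{ii}_{34}\}$, $\{\mathrm{ip}_1, \mathrm{ii}_{04}\}$, $\{\mathrm{ip}_1, \mathrm{ii}_{44}\}$, $\{\mathrm{ip}_2, \mathrm{ip}_3\}$, $\{\mathrm{ip}_2, \mathrm{ip}_4\}$, $\{\mathrm{ip}_2, {<}\}$, $\{\mathrm{ip}_3, \mathrm{ii}_{14}\}$, $\{\mathrm{ip}_3, \mathrm{ii}_{24}\}$, $\{\mathrm{ip}_3, \mathrm{ii}_{34}\}$, $\{\mathrm{ip}_3, \mathrm{ii}_{04}\}$, $\{\mathrm{ip}_3, \mathrm{ii}_{44}\}$, $\{\mathrm{ip}_4, \mathrm{ii}_{14}\}$, $\{\mathrm{ip}_4, \mathrm{ii}_{24}\}$, $\{\mathrm{ip}_4,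 \mathrm{ii}_{34}\}$, $\{\mathrm{ip}_4, \mathrm{ii}_{04}\}$, $\{\mathrm{ip}_4, \mathrm{ii}_{44}\}$. The maximally $\mathfrak R^+$-incomplete sets are exactly the following 4 sets: $\{\mathrm{ip}_0, \mathrm{ip}_1, \mathrm{ii}_{14}, {<}, =_i, =_p\}$, $\{\mathrm{ip}_2, \mathrm{ii}_{03}, \mathrm{ii}_{04}, \mathrm{ii}_{14}, \mathrm{ii}_{24}, \mathrm{ii}_{34}, \mathrm{ii}_{44}, =_i, =_p\}$, $\{\mathrm{ip}_3, \mathrm{ip}_4, \mathrm{ii}_{03}, {<}, =_i, =_p\}$, $\{\mathrm{ii}_{03}, \mathrm{ii}_{04}, \mathrm{ii}_{14}, \mathrm{ii}_{24}, \mathrm{ii}_{34}, \mathrm{ii}_{44}, {<}, =_i, =_p\}$. 2. Over the class of all unbounded linear orders (those in which every point has a strictly larger point and a strictly smaller point), the minimally $\mathfrak R^+$-complete sets are exactly the following 34 sets: $\{\mathrm{ip}_0, \mathrm{ip}_2\}$, $\{\mathrm{ip}_0, \mathrm{ip}_3\}$, $\{\mathrm{ip}_0, \mathrm{ip}_4\}$,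 $\{\mathrm{ip}_0, \mathrm{ii}_{24}\}$, $\{\mathrm{ip}_0, \mathrm{ii}_{03}\}$, $\{\mathrm{ip}_0, \mathrm{ii}_{34}\}$, $\{\mathrm{ip}_0, \mathrm{ii}_{04}\}$, $\{\mathrm{ip}_0, \mathrm{ii}_{44}\}$, $\{\mathrm{ip}_1, \mathrm{ip}_2\}$, $\{\mathrm{ip}_1, \mathrm{ip}_3\}$, $\{\mathrm{ip}_1, \mathrm{ip}_4\}$, $\{\mathrm{ip}_1, \mathrm{ii}_{24}\}$, $\{\mathrm{ip}_1, \mathrm{ii}_{03}\}$, $\{\mathrm{ip}_1, \mathrm{ii}_{34}\}$, $\{\mathrm{ip}_1, \mathrm{ii}_{04}\}$, $\{\mathrm{ip}_1, \mathrm{ii}_{44}\}$, $\{\mathrm{ip}_2, \mathrm{ip}_3\}$, $\{\mathrm{ip}_2, \mathrm{ip}_4\}$, $\{\mathrm{ip}_2, \mathrm{ii}_{14}\}$, $\{\mathrm{ip}_2, \mathrm{ii}_{04}, \mathrm{ii}_{24}\}$, $\{\mathrm{ip}_2, \mathrm{ii}_{03}\}$, $\{\mathrm{ip}_2, \mathrm{ii}_{34}\}$,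 $\{\mathrm{ip}_2, \mathrm{ii}_{04}, {<}\}$, $\{\mathrm{ip}_2, \mathrm{ii}_{44}\}$, $\{\mathrm{ip}_3, \mathrm{ii}_{14}\}$, $\{\mathrm{ip}_3, \mathrm{ii}_{24}\}$, $\{\mathrm{ip}_3, \mathrm{ii}_{34}\}$, $\{\mathrm{ip}_3, \mathrm{ii}_{04}\}$, $\{\mathrm{ip}_3, \mathrm{ii}_{44}\}$, $\{\mathrm{ip}_4, \mathrm{ii}_{14}\}$, $\{\mathrm{ip}_4, \mathrm{ii}_{24}\}$, $\{\mathrm{ip}_4, \mathrm{ii}_{34}\}$, $\{\mathrm{ip}_4, \mathrm{ii}_{04}\}$, $\{\mathrm{ip}_4, \mathrm{ii}_{44}\}$. The maximally $\mathfrak R^+$-incomplete sets are exactly the following 5 sets: $\{\mathrm{ip}_0, \mathrm{ip}_1, \mathrm{ii}_{14}, {<}, =_i, =_p\}$, $\{\mathrm{ip}_2, \mathrm{ii}_{24}, {<}, =_i, =_p\}$, $\{\mathrm{ip}_2, \mathrm{ii}_{04}, =_i, =_p\}$, $\{\mathrm{ip}_3, \mathrm{ip}_4, \mathrm{ii}_{03},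 {<}, =_i, =_p\}$, $\{\mathrm{ii}_{03}, \mathrm{ii}_{04}, \mathrm{ii}_{14}, \mathrm{ii}_{24}, \mathrm{ii}_{34}, \mathrm{ii}_{44}, {<}, =_i, =_p\}$. -/

import Mathlib

universe u

namespace PointInterval

/-- An interval over a linear order `D`: an ordered pair `[lo, hi]` of points with `lo < hi`. -/
structure Ivl (D : Type u) [LinearOrder D] : Type u where
  lo : D
  hi : D
  lo_lt_hi : lo < hi

/-- The point-point relations: strict order and equality of points. -/
inductive PRel : Type
  | lt
  | eq

/-- The interval-point relations; `reg k` says that the point lies in region `k` of the partition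
of the order induced by the interval. -/
inductive MRel : Type
  | reg0
  | reg1
  | reg2
  | reg3
  | reg4

/-- The interval-interval relations, up to inverses: equality, meets, starts, finishes, during,
overlaps and before. -/
inductive IRel : Type
  | eq
  | meets
  | starts
  | finishes
  | during
  | overlaps
  | before

/-- The fourteen basic relations, up to inverses, of the two-sorted point-interval language. -/
inductive Rel : Type
  | pp (r : PRel)
  | ip (r : MRel)
  | ii (r : IRel)

/-! In the names below, `ipk` relates an interval to a point in its region `k`, and `iikl` relates
an interval `I` to an interval `J` whose left and right endpoints lie in the regions `k` and `l`
of `I`. Region 0 of `[a, b]` is `x < a`, region 1 is `x = a`, region 2 is `a < x < b`,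
region 3 is `x = b`, and region 4 is `b < x`. -/

abbrev Rel.lt : Rel := .pp .lt
abbrev Rel.eqp : Rel := .pp .eq
abbrev Rel.ip0 : Rel := .ip .reg0
abbrev Rel.ip1 : Rel := .ip .reg1
abbrev Rel.ip2 : Rel := .ip .reg2
abbrev Rel.ip3 : Rel := .ip .reg3
abbrev Rel.ip4 : Rel := .ip .reg4
abbrev Rel.eqi : Rel := .ii .eq
abbrev Rel.ii34 : Rel := .ii .meets
abbrev Rel.ii14 : Rel := .ii .starts
abbrev Rel.ii03 : Rel := .ii .finishes
abbrev Rel.ii04 : Rel := .ii .during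
abbrev Rel.ii24 : Rel := .ii .overlaps
abbrev Rel.ii44 : Rel := .ii .before

section Semantics

variable {D : Type u} [LinearOrder D]

def PRel.Holds : PRel → D → D → Prop
  | .lt, x, y => x < y
  | .eq, x, y => x = y

def MRel.Holds : MRel → Ivl D → D → Prop
  | .reg0, I, x => x < I.lo
  | .reg1, I, x => x = I.lo
  | .reg2, I, x => I.lo < x ∧ x < I.hi
  | .reg3, I, x => x = I.hi
  | .reg4, I, x => I.hi < x

def IRel.Holds : IRel → Ivl D → Ivl D → Prop
  | .eq, I, J => I = J
  | .meets, I, J => I.hi = J.lo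
  | .starts, I, J => I.lo = J.lo ∧ I.hi < J.hi
  | .finishes, I, J => J.lo < I.lo ∧ I.hi = J.hi
  | .during, I, J => J.lo < I.lo ∧ I.hi < J.hi
  | .overlaps, I, J => I.lo < J.lo ∧ J.lo < I.hi ∧ I.hi < J.hi
  | .before, I, J => I.hi < J.lo

end Semantics

/-- Two-sorted first-order formulas without built-in equality over the relation symbols in `S`,
with `m` free point variables and `n` free interval variables. The quantifiers bind variable `0`
of their sort; the remaining connectives and the existential quantifiers are definable. -/
inductive Formula (S : Set Rel) : ℕ → ℕ → Type
  | falsum {m n : ℕ} : Formula S m n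
  | atomPP {m n : ℕ} (r : PRel) (hr : Rel.pp r ∈ S) (x y : Fin m) : Formula S m n
  | atomIP {m n : ℕ} (r : MRel) (hr : Rel.ip r ∈ S) (x : Fin n) (y : Fin m) : Formula S m n
  | atomII {m n : ℕ} (r : IRel) (hr : Rel.ii r ∈ S) (x y : Fin n) : Formula S m n
  | imp {m n : ℕ} (φ ψ : Formula S m n) : Formula S m n
  | allP {m n : ℕ} (φ : Formula S (m + 1) n) : Formula S m n
  | allI {m n : ℕ} (φ : Formula S m (n + 1)) : Formula S m n

/-- Truth of a formula in the concrete point-interval structure over the linear order `D`, under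
an assignment of points and intervals to its free variables. -/
def Formula.Holds {S : Set Rel} {D : Type u} [LinearOrder D] :
    {m n : ℕ} → Formula S m n → (Fin m → D) → (Fin n → Ivl D) → Prop
  | _, _, .falsum, _, _ => False
  | _, _, .atomPP r _ x y, p, _ => r.Holds (p x) (p y)
  | _, _, .atomIP r _ x y, p, q => r.Holds (q x) (p y)
  | _, _, .atomII r _ x y, _, q => r.Holds (q x) (q y)
  | _, _, .imp φ ψ, p, q => φ.Holds p q → ψ.Holds p q
  | _, _, .allP φ, p, q => ∀ a : D, φ.Holds (Matrix.vecCons a p) q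
  | _, _, .allI φ, p, q => ∀ I : Ivl D, φ.Holds p (Matrix.vecCons I q)

/-- A class of linear orders. -/
abbrev OrderClass : Type (u + 1) := (D : Type u) → LinearOrder D → Prop

/-- The class of all dense linear orders. -/
def Den : OrderClass.{u} := fun D _ => ∀ a b : D, a < b → ∃ c, a < c ∧ c < b

/-- The class of all linear orders unbounded in both directions. -/
def Unb : OrderClass.{u} := fun D _ => ∀ a : D, (∃ b, a < b) ∧ (∃ c, c < a)

/-- First-order logic with the relation symbols in `S` defines the relation `r` over the class `C`:
one formula with two free variables, of the sorts required by `r`, is equivalent to `r` in the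
concrete point-interval structure over every member of `C`. -/
def Defines (C : OrderClass.{u}) (S : Set Rel) : Rel → Prop
  | .pp r => ∃ φ : Formula S 2 0, ∀ (D : Type u) [h : LinearOrder D], C D h →
      ∀ x y : D, φ.Holds ![x, y] ![] ↔ r.Holds x y
  | .ip r => ∃ φ : Formula S 1 1, ∀ (D : Type u) [h : LinearOrder D], C D h →
      ∀ (I : Ivl D) (x : D), φ.Holds ![x] ![I] ↔ r.Holds I x
  | .ii r => ∃ φ : Formula S 0 2, ∀ (D : Type u) [h : LinearOrder D], C D h →
      ∀ I J : Ivl D, φ.Holds ![] ![I, J] ↔ r.Holds I J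

/-- `S` is `S'`-complete over `C`. -/
def IsComplete (C : OrderClass.{u}) (S' S : Set Rel) : Prop :=
  ∀ r ∈ S', Defines C S r

/-- `S` is `S'`-incomplete over `C`. -/
def IsIncomplete (C : OrderClass.{u}) (S' S : Set Rel) : Prop :=
  ∃ r ∈ S', ¬ Defines C S r

/-- `S` is minimally `S'`-complete over `C`. -/
def IsMinimallyComplete (C : OrderClass.{u}) (S' S : Set Rel) : Prop :=
  IsComplete C S' S ∧ ∀ T : Set Rel, T ⊂ S → IsIncomplete C S' T

/-- `S` is maximally `S'`-incomplete over `C`. -/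
def IsMaximallyIncomplete (C : OrderClass.{u}) (S' S : Set Rel) : Prop :=
  IsIncomplete C S' S ∧ ∀ T : Set Rel, S ⊂ T → IsComplete C S' T

/-- The set of all fourteen basic relations. -/
def RPlus : Set Rel := Set.univ

/-- The minimally complete sets over the dense linear orders. -/
def denMcs : Set (Set Rel) :=
  {{Rel.ip0, Rel.ip2},
    {Rel.ip0, Rel.ip3},
    {Rel.ip0, Rel.ip4},
    {Rel.ip0, Rel.ii24},
    {Rel.ip0, Rel.ii03},
    {Rel.ip0, Rel.ii34},
    {Rel.ip0, Rel.ii04},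
    {Rel.ip0, Rel.ii44},
    {Rel.ip1, Rel.ip2},
    {Rel.ip1, Rel.ip3},
    {Rel.ip1, Rel.ip4},
    {Rel.ip1, Rel.ii24},
    {Rel.ip1, Rel.ii03},
    {Rel.ip1, Rel.ii34},
    {Rel.ip1, Rel.ii04},
    {Rel.ip1, Rel.ii44},
    {Rel.ip2, Rel.ip3},
    {Rel.ip2, Rel.ip4},
    {Rel.ip2, Rel.lt},
    {Rel.ip3, Rel.ii14},
    {Rel.ip3, Rel.ii24},
    {Rel.ip3, Rel.ii34},
    {Rel.ip3, Rel.ii04},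
    {Rel.ip3, Rel.ii44},
    {Rel.ip4, Rel.ii14},
    {Rel.ip4, Rel.ii24},
    {Rel.ip4, Rel.ii34},
    {Rel.ip4, Rel.ii04},
    {Rel.ip4, Rel.ii44}}

/-- The maximally incomplete sets over the dense linear orders. -/
def denMIS : Set (Set Rel) :=
  {{Rel.ip0, Rel.ip1, Rel.ii14, Rel.lt, Rel.eqi, Rel.eqp},
    {Rel.ip2, Rel.ii03, Rel.ii04, Rel.ii14, Rel.ii24, Rel.ii34, Rel.ii44, Rel.eqi, Rel.eqp},
    {Rel.ip3, Rel.ip4, Rel.ii03, Rel.lt, Rel.eqi, Rel.eqp},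
    {Rel.ii03, Rel.ii04, Rel.ii14, Rel.ii24, Rel.ii34, Rel.ii44, Rel.lt, Rel.eqi, Rel.eqp}}

/-- The minimally complete sets over the unbounded linear orders. -/
def unbMcs : Set (Set Rel) :=
  {{Rel.ip0, Rel.ip2},
    {Rel.ip0, Rel.ip3},
    {Rel.ip0, Rel.ip4},
    {Rel.ip0, Rel.ii24},
    {Rel.ip0, Rel.ii03},
    {Rel.ip0, Rel.ii34},
    {Rel.ip0, Rel.ii04},
    {Rel.ip0, Rel.ii44},
    {Rel.ip1, Rel.ip2},
    {Rel.ip1, Rel.ip3},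
    {Rel.ip1, Rel.ip4},
    {Rel.ip1, Rel.ii24},
    {Rel.ip1, Rel.ii03},
    {Rel.ip1, Rel.ii34},
    {Rel.ip1, Rel.ii04},
    {Rel.ip1, Rel.ii44},
    {Rel.ip2, Rel.ip3},
    {Rel.ip2, Rel.ip4},
    {Rel.ip2, Rel.ii14},
    {Rel.ip2, Rel.ii04, Rel.ii24},
    {Rel.ip2, Rel.ii03},
    {Rel.ip2, Rel.ii34},
    {Rel.ip2, Rel.ii04, Rel.lt},
    {Rel.ip2, Rel.ii44},
    {Rel.ip3, Rel.ii14},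
    {Rel.ip3, Rel.ii24},
    {Rel.ip3, Rel.ii34},
    {Rel.ip3, Rel.ii04},
    {Rel.ip3, Rel.ii44},
    {Rel.ip4, Rel.ii14},
    {Rel.ip4, Rel.ii24},
    {Rel.ip4, Rel.ii34},
    {Rel.ip4, Rel.ii04},
    {Rel.ip4, Rel.ii44}}

/-- The maximally incomplete sets over the unbounded linear orders. -/
def unbMIS : Set (Set Rel) :=
  {{Rel.ip0, Rel.ip1, Rel.ii14, Rel.lt, Rel.eqi, Rel.eqp},
    {Rel.ip2, Rel.ii24, Rel.lt, Rel.eqi, Rel.eqp},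
    {Rel.ip2, Rel.ii04, Rel.eqi, Rel.eqp},
    {Rel.ip3, Rel.ip4, Rel.ii03, Rel.lt, Rel.eqi, Rel.eqp},
    {Rel.ii03, Rel.ii04, Rel.ii14, Rel.ii24, Rel.ii34, Rel.ii44, Rel.lt, Rel.eqi, Rel.eqp}}

end PointInterval

-- Definability composes: relations already defined may be used as atoms. Completeness is therefore
-- shown by chains of explicit definitions, and incompleteness by symmetries. Every relation is an
-- order condition on endpoints, so `<`, `ip1` and `ip3` define everything
-- (`isComplete_of_lt_ip1_ip3`); `<` itself is redundant there, since x < y iff some interval runs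
-- from x to y. As `ip0` defines `ip1`, the pairs with `ip0` or `ip1` reduce to recovering, from
-- `ip1` and one more relation, the points inside, at the end of, or after an interval. Reversing
-- the order gives the pairs with `ip3` or `ip4`. With `ip2` as the only interval-point relation,
-- endpoints are read off from interiors. Over dense orders `<` suffices for this. Over unbounded
-- orders `ip2` defines betweenness of points; the other members of the set orient it
-- (`defines_lt_unb_of_ip2`) and carry the endpoints found for intervals with nonempty interior over
-- to the intervals with empty interior. For incompleteness, take surjections of the points and of
-- the intervals that need not be induced by one map: if they preserve all relations in S, they
-- preserve whatever S defines (`preserves_of_defines`). One such pair on ℚ, on ℚ ∩ [0, 1] or on ℤ,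
-- up to order reversal, refutes each listed incomplete set. What is left is finite combinatorics:
-- each set of relations contains a listed complete set or lies in a listed incomplete one.

universe v

namespace PointInterval

/-! ### Derived connectives and renaming of variables. -/

namespace Formula

variable {S T : Set Rel} {m n m' n' : ℕ}

def neg (φ : Formula S m n) : Formula S m n := .imp φ .falsum
def conj (φ ψ : Formula S m n) : Formula S m n := neg (.imp φ (neg ψ))
def disj (φ ψ : Formula S m n) : Formula S m n := .imp (neg φ) ψ
def exP (φ : Formula S (m + 1) n) : Formula S m n := neg (.allP (neg φ))
def exI (φ : Formula S m (n + 1)) : Formula S m n := neg (.allI (neg φ))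

section Holds

variable {D : Type u} [LinearOrder D] {p : Fin m → D} {q : Fin n → Ivl D}

@[simp] theorem holds_atomPP {r : PRel} (hr : Rel.pp r ∈ S) (x y : Fin m) :
    (atomPP r hr x y : Formula S m n).Holds p q ↔ r.Holds (p x) (p y) := Iff.rfl

@[simp] theorem holds_atomIP {r : MRel} (hr : Rel.ip r ∈ S) (x : Fin n) (y : Fin m) :
    (atomIP r hr x y : Formula S m n).Holds p q ↔ r.Holds (q x) (p y) := Iff.rfl

@[simp] theorem holds_atomII {r : IRel} (hr : Rel.ii r ∈ S) (x y : Fin n) :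
    (atomII r hr x y : Formula S m n).Holds p q ↔ r.Holds (q x) (q y) := Iff.rfl

@[simp] theorem holds_imp (φ ψ : Formula S m n) :
    (imp φ ψ).Holds p q ↔ (φ.Holds p q → ψ.Holds p q) := Iff.rfl

@[simp] theorem holds_allP (φ : Formula S (m + 1) n) :
    φ.allP.Holds p q ↔ ∀ a : D, φ.Holds (Matrix.vecCons a p) q := Iff.rfl

@[simp] theorem holds_allI (φ : Formula S m (n + 1)) :
    φ.allI.Holds p q ↔ ∀ I : Ivl D, φ.Holds p (Matrix.vecCons I q) := Iff.rfl

@[simp] theorem holds_neg (φ : Formula S m n) : φ.neg.Holds p q ↔ ¬ φ.Holds p q := Iff.rfl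

@[simp] theorem holds_conj (φ ψ : Formula S m n) :
    (conj φ ψ).Holds p q ↔ φ.Holds p q ∧ ψ.Holds p q := by
  simp [conj]

@[simp] theorem holds_disj (φ ψ : Formula S m n) :
    (disj φ ψ).Holds p q ↔ φ.Holds p q ∨ ψ.Holds p q := by
  simp [disj, or_iff_not_imp_left]

@[simp] theorem holds_exP (φ : Formula S (m + 1) n) :
    φ.exP.Holds p q ↔ ∃ a : D, φ.Holds (Matrix.vecCons a p) q := by
  simp [exP]

@[simp] theorem holds_exI (φ : Formula S m (n + 1)) :
    φ.exI.Holds p q ↔ ∃ I : Ivl D, φ.Holds p (Matrix.vecCons I q) := by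
  simp [exI]

end Holds

/-- Extend a renaming of variables under a binder. -/
def lift {k l : ℕ} (f : Fin k → Fin l) : Fin (k + 1) → Fin (l + 1) :=
  Matrix.vecCons 0 (Fin.succ ∘ f)

theorem vecCons_comp_lift {α : Type*} {k l : ℕ} (f : Fin k → Fin l) (a : α) (p : Fin l → α) :
    Matrix.vecCons a p ∘ lift f = Matrix.vecCons a (p ∘ f) := by
  funext i
  refine Fin.cases ?_ (fun j => ?_) i <;> simp [lift]

/-- Renaming of the free variables. -/
def rename : {m n : ℕ} → Formula S m n → {m' n' : ℕ} → (Fin m → Fin m') → (Fin n → Fin n') →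
    Formula S m' n'
  | _, _, .falsum, _, _, _, _ => .falsum
  | _, _, .atomPP r hr x y, _, _, f, _ => .atomPP r hr (f x) (f y)
  | _, _, .atomIP r hr x y, _, _, f, g => .atomIP r hr (g x) (f y)
  | _, _, .atomII r hr x y, _, _, _, g => .atomII r hr (g x) (g y)
  | _, _, .imp φ ψ, _, _, f, g => .imp (φ.rename f g) (ψ.rename f g)
  | _, _, .allP φ, _, _, f, g => .allP (φ.rename (lift f) g)
  | _, _, .allI φ, _, _, f, g => .allI (φ.rename f (lift g))

theorem holds_rename {D : Type u} [LinearOrder D] (φ : Formula S m n) {m' n' : ℕ}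
    (f : Fin m → Fin m') (g : Fin n → Fin n') (p : Fin m' → D) (q : Fin n' → Ivl D) :
    (φ.rename f g).Holds p q ↔ φ.Holds (p ∘ f) (q ∘ g) := by
  induction φ generalizing m' n' with
  | falsum => rfl
  | atomPP => rfl
  | atomIP => rfl
  | atomII => rfl
  | imp φ ψ ihφ ihψ => simp [rename, ihφ, ihψ]
  | allP φ ih => simp [rename, ih, vecCons_comp_lift]
  | allI φ ih => simp [rename, ih, vecCons_comp_lift]

/-- Apply a formula in two point variables to the variables `x` and `y`. -/
def appPP (φ : Formula S 2 0) (x y : Fin m) : Formula S m n := φ.rename ![x, y] ![]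

/-- Apply a formula in an interval and a point variable to the variables `x` and `y`. -/
def appIP (φ : Formula S 1 1) (x : Fin n) (y : Fin m) : Formula S m n := φ.rename ![y] ![x]

/-- Apply a formula in two interval variables to the variables `x` and `y`. -/
def appII (φ : Formula S 0 2) (x y : Fin n) : Formula S m n := φ.rename ![] ![x, y]

section App

variable {D : Type u} [LinearOrder D] {p : Fin m → D} {q : Fin n → Ivl D}

@[simp] theorem holds_appPP (φ : Formula S 2 0) (x y : Fin m) :
    (φ.appPP x y : Formula S m n).Holds p q ↔ φ.Holds ![p x, p y] ![] := by
  rw [appPP, holds_rename]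
  have h1 : p ∘ ![x, y] = ![p x, p y] := by funext i; fin_cases i <;> rfl
  rw [h1, Subsingleton.elim (q ∘ ![]) ![]]

@[simp] theorem holds_appIP (φ : Formula S 1 1) (x : Fin n) (y : Fin m) :
    (φ.appIP x y : Formula S m n).Holds p q ↔ φ.Holds ![p y] ![q x] := by
  rw [appIP, holds_rename]
  have h1 : p ∘ ![y] = ![p y] := by funext i; fin_cases i; rfl
  have h2 : q ∘ ![x] = ![q x] := by funext i; fin_cases i; rfl
  rw [h1, h2]

@[simp] theorem holds_appII (φ : Formula S 0 2) (x y : Fin n) :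
    (φ.appII x y : Formula S m n).Holds p q ↔ φ.Holds ![] ![q x, q y] := by
  rw [appII, holds_rename]
  have h1 : q ∘ ![x, y] = ![q x, q y] := by funext i; fin_cases i <;> rfl
  rw [h1, Subsingleton.elim (p ∘ ![]) ![]]

end App

end Formula

open Formula

/-! ### Transitivity of definability. -/

section Closure

variable {C : OrderClass.{u}} {S T : Set Rel}

/-- Each atom is replaced by its definition, renamed to the variables of the atom. -/
theorem Formula.exists_equiv_of_defines (h : ∀ r ∈ T, Defines C S r) {m n : ℕ}
    (φ : Formula T m n) :
    ∃ ψ : Formula S m n, ∀ (D : Type u) [hD : LinearOrder D], C D hD →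
      ∀ (p : Fin m → D) (q : Fin n → Ivl D), ψ.Holds p q ↔ φ.Holds p q := by
  induction φ with
  | falsum => exact ⟨.falsum, fun _ _ _ _ _ => Iff.rfl⟩
  | atomPP r hr x y =>
    obtain ⟨ψ, hψ⟩ := h _ hr
    exact ⟨ψ.appPP x y, fun D _ hD p q => by simp [hψ D hD]⟩
  | atomIP r hr x y =>
    obtain ⟨ψ, hψ⟩ := h _ hr
    exact ⟨ψ.appIP x y, fun D _ hD p q => by simp [hψ D hD]⟩
  | atomII r hr x y =>
    obtain ⟨ψ, hψ⟩ := h _ hr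
    exact ⟨ψ.appII x y, fun D _ hD p q => by simp [hψ D hD]⟩
  | imp _ _ ih₁ ih₂ =>
    obtain ⟨ψ₁, h₁⟩ := ih₁
    obtain ⟨ψ₂, h₂⟩ := ih₂
    exact ⟨.imp ψ₁ ψ₂, fun D _ hD p q => by simp [h₁ D hD, h₂ D hD]⟩
  | allP _ ih =>
    obtain ⟨ψ, h⟩ := ih
    exact ⟨.allP ψ, fun D _ hD p q => by simp [h D hD]⟩
  | allI _ ih =>
    obtain ⟨ψ, h⟩ := ih
    exact ⟨.allI ψ, fun D _ hD p q => by simp [h D hD]⟩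

theorem Defines.trans (h : ∀ r ∈ T, Defines C S r) {r : Rel} (hr : Defines C T r) :
    Defines C S r := by
  cases r with
  | pp r =>
    obtain ⟨φ, hφ⟩ := hr
    obtain ⟨ψ, hψ⟩ := φ.exists_equiv_of_defines h
    exact ⟨ψ, fun D _ hD x y => (hψ D hD _ _).trans (hφ D hD x y)⟩
  | ip r =>
    obtain ⟨φ, hφ⟩ := hr
    obtain ⟨ψ, hψ⟩ := φ.exists_equiv_of_defines h
    exact ⟨ψ, fun D _ hD x y => (hψ D hD _ _).trans (hφ D hD x y)⟩
  | ii r =>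
    obtain ⟨φ, hφ⟩ := hr
    obtain ⟨ψ, hψ⟩ := φ.exists_equiv_of_defines h
    exact ⟨ψ, fun D _ hD x y => (hψ D hD _ _).trans (hφ D hD x y)⟩

theorem Defines.of_mem {r : Rel} (hr : r ∈ S) : Defines C S r := by
  cases r with
  | pp r => exact ⟨.atomPP r hr 0 1, fun D _ _ x y => by simp⟩
  | ip r => exact ⟨.atomIP r hr 0 0, fun D _ _ x y => by simp⟩
  | ii r => exact ⟨.atomII r hr 0 1, fun D _ _ x y => by simp⟩

theorem Defines.mono (h : S ⊆ T) {r : Rel} (hr : Defines C S r) : Defines C T r :=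
  .trans (fun _ hs => .of_mem (h hs)) hr

/-- The set of all basic relations defined by `S` over `C`. -/
def definableClosure (C : OrderClass.{u}) (S : Set Rel) : Set Rel := {r | Defines C S r}

/-- Lets a definition use every relation already known to be definable as if it were a symbol of the
language. -/
theorem Defines.of_closure {r : Rel} (hr : Defines C (definableClosure C S) r) : Defines C S r :=
  .trans (fun _ h => h) hr

variable {m n : ℕ}

/-- The atomic formula of a definable relation between points. -/
def Formula.defPP {r : PRel} (h : Defines C S (.pp r)) (x y : Fin m) :
    Formula (definableClosure C S) m n := .atomPP r h x y

/-- The atomic formula of a definable relation between intervals and points. -/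
def Formula.defIP {r : MRel} (h : Defines C S (.ip r)) (x : Fin n) (y : Fin m) :
    Formula (definableClosure C S) m n := .atomIP r h x y

/-- The atomic formula of a definable relation between intervals. -/
def Formula.defII {r : IRel} (h : Defines C S (.ii r)) (x y : Fin n) :
    Formula (definableClosure C S) m n := .atomII r h x y

variable {D : Type u} [LinearOrder D] {p : Fin m → D} {q : Fin n → Ivl D}

@[simp] theorem Formula.holds_defPP {r : PRel} (h : Defines C S (.pp r)) (x y : Fin m) :
    (defPP h x y).Holds p q ↔ r.Holds (p x) (p y) := Iff.rfl

@[simp] theorem Formula.holds_defIP {r : MRel} (h : Defines C S (.ip r)) (x : Fin n) (y : Fin m) :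
    (defIP h x y).Holds p q ↔ r.Holds (q x) (p y) := Iff.rfl

@[simp] theorem Formula.holds_defII {r : IRel} (h : Defines C S (.ii r)) (x y : Fin n) :
    (defII h x y).Holds p q ↔ r.Holds (q x) (q y) := Iff.rfl

end Closure

/-! ### Order reversal. -/

section Duality

/-- The relation obtained by reversing the order. -/
def MRel.dual : MRel → MRel
  | .reg0 => .reg4
  | .reg1 => .reg3
  | .reg2 => .reg2
  | .reg3 => .reg1
  | .reg4 => .reg0

/-- The relation obtained, up to inverses, by reversing the order. -/
def IRel.dual : IRel → IRel
  | .starts => .finishes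
  | .finishes => .starts
  | r => r

/-- The relation obtained, up to inverses, by reversing the order. -/
def Rel.dual : Rel → Rel
  | .pp r => .pp r
  | .ip r => .ip r.dual
  | .ii r => .ii r.dual

@[simp] theorem Rel.dual_dual (r : Rel) : r.dual.dual = r := by
  rcases r with r | r | r <;> cases r <;> rfl

theorem Rel.mem_preimage_dual {S : Set Rel} {r : Rel} (h : r ∈ S) : r.dual ∈ Rel.dual ⁻¹' S := by
  simpa using h

/-- The interval of the reversed order with the same endpoints. -/
def Ivl.dual {D : Type u} [LinearOrder D] (I : Ivl D) : Ivl Dᵒᵈ :=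
  ⟨OrderDual.toDual I.hi, OrderDual.toDual I.lo, OrderDual.toDual_lt_toDual.2 I.lo_lt_hi⟩

theorem Ivl.dual_surjective {D : Type u} [LinearOrder D] :
    Function.Surjective (Ivl.dual : Ivl D → Ivl Dᵒᵈ) := fun J =>
  ⟨⟨OrderDual.ofDual J.hi, OrderDual.ofDual J.lo, OrderDual.ofDual_lt_ofDual.2 J.lo_lt_hi⟩, rfl⟩

variable {C : OrderClass.{u}} {S : Set Rel} {D : Type u} [LinearOrder D]

theorem Ivl.ext' {I J : Ivl D} (h₁ : I.lo = J.lo) (h₂ : I.hi = J.hi) : I = J := by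
  cases I; cases J; simp_all

theorem Ivl.eq_iff {I J : Ivl D} : I = J ↔ I.lo = J.lo ∧ I.hi = J.hi :=
  ⟨fun h => by simp [h], fun h => Ivl.ext' h.1 h.2⟩

theorem PRel.holds_toDual (r : PRel) (x y : D) :
    r.Holds (OrderDual.toDual x) (OrderDual.toDual y) ↔ r.Holds y x := by
  cases r <;> simp [PRel.Holds, eq_comm]

theorem MRel.holds_dual (r : MRel) (I : Ivl D) (x : D) :
    r.Holds I.dual (OrderDual.toDual x) ↔ r.dual.Holds I x := by
  cases r <;> simp [MRel.Holds, MRel.dual, Ivl.dual, and_comm]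

/-- Whether reversing the order turns the relation into the inverse of its dual. -/
def IRel.swaps : IRel → Bool
  | .meets | .overlaps | .before => true
  | _ => false

theorem IRel.holds_dual (r : IRel) (I J : Ivl D) :
    r.Holds I.dual J.dual ↔ if r.swaps then r.dual.Holds J I else r.dual.Holds I J := by
  cases r <;> simp [IRel.Holds, IRel.dual, Ivl.dual, IRel.swaps, eq_comm, Ivl.eq_iff, and_comm,
    and_assoc, and_left_comm]

/-- The formula that expresses `φ` over the reversed order. -/
def Formula.dual : {m n : ℕ} → Formula S m n → Formula (Rel.dual ⁻¹' S) m n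
  | _, _, .falsum => .falsum
  | _, _, .atomPP r hr x y => .atomPP r hr y x
  | _, _, .atomIP r hr x y => .atomIP r.dual (Rel.mem_preimage_dual hr) x y
  | _, _, .atomII r hr x y =>
    if r.swaps then .atomII r.dual (Rel.mem_preimage_dual hr) y x
    else .atomII r.dual (Rel.mem_preimage_dual hr) x y
  | _, _, .imp φ ψ => .imp φ.dual ψ.dual
  | _, _, .allP φ => .allP φ.dual
  | _, _, .allI φ => .allI φ.dual

theorem Formula.holds_dual {m n : ℕ} (φ : Formula S m n) (p : Fin m → D) (q : Fin n → Ivl D) :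
    φ.dual.Holds p q ↔ φ.Holds (OrderDual.toDual ∘ p) (Ivl.dual ∘ q) := by
  have hc : ∀ {α β : Type u} {k : ℕ} (f : α → β) (a : α) (p : Fin k → α),
      Matrix.vecCons (f a) (f ∘ p) = f ∘ Matrix.vecCons a p := by
    intro α β k f a p
    funext i
    refine Fin.cases ?_ (fun j => ?_) i <;> simp
  induction φ with
  | falsum => rfl
  | atomPP r hr x y => exact (PRel.holds_toDual r _ _).symm
  | atomIP r hr x y => exact (MRel.holds_dual r _ _).symm
  | atomII r hr x y =>
    have := IRel.holds_dual r (q x) (q y)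
    by_cases hs : r.swaps = true <;> simp [Formula.dual, hs, this] <;> rfl
  | imp φ ψ ihφ ihψ => simp [Formula.dual, ihφ, ihψ]
  | allP φ ih =>
    simp only [Formula.dual, holds_allP, ih, OrderDual.toDual.surjective.forall, hc]
  | allI φ ih =>
    simp only [Formula.dual, holds_allI, ih, Ivl.dual_surjective.forall, hc]

theorem Defines.dual (hC : ∀ (D : Type u) (h : LinearOrder D), C D h → C Dᵒᵈ inferInstance)
    {r : Rel} (hr : Defines C S r) : Defines C (Rel.dual ⁻¹' S) r.dual := by
  cases r with
  | pp r =>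
    obtain ⟨φ, hφ⟩ := hr
    -- Reversing the order exchanges the two arguments of a point relation, so the variables are
    -- swapped back; the same happens below for the interval relations that turn into their
    -- inverses.
    refine ⟨φ.dual.appPP 1 0, fun D _ hD x y => ?_⟩
    have h := hφ Dᵒᵈ (hC D _ hD) (OrderDual.toDual y) (OrderDual.toDual x)
    rw [PRel.holds_toDual] at h
    simp only [holds_appPP, holds_dual, ← h]
    exact iff_of_eq (congrArg₂ _ (by funext i; fin_cases i <;> rfl) (Subsingleton.elim _ _))
  | ip r =>
    obtain ⟨φ, hφ⟩ := hr
    refine ⟨φ.dual, fun D _ hD I x => ?_⟩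
    have h := hφ Dᵒᵈ (hC D _ hD) I.dual (OrderDual.toDual x)
    rw [MRel.holds_dual] at h
    simp only [holds_dual, ← h]
    exact iff_of_eq (congrArg₂ _ (by funext i; fin_cases i; rfl) (by funext i; fin_cases i; rfl))
  | ii r =>
    obtain ⟨φ, hφ⟩ := hr
    refine ⟨if r.swaps then φ.dual.appII 1 0 else φ.dual, fun D _ hD I J => ?_⟩
    by_cases hs : r.swaps = true
    · have h := hφ Dᵒᵈ (hC D _ hD) J.dual I.dual
      rw [IRel.holds_dual, if_pos hs] at h
      simp only [if_pos hs, holds_appII, holds_dual, ← h]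
      exact iff_of_eq (congrArg₂ _ (Subsingleton.elim _ _) (by funext i; fin_cases i <;> rfl))
    · have h := hφ Dᵒᵈ (hC D _ hD) I.dual J.dual
      rw [IRel.holds_dual, if_neg hs] at h
      simp only [if_neg hs, holds_dual, ← h]
      exact iff_of_eq (congrArg₂ _ (Subsingleton.elim _ _) (by funext i; fin_cases i <;> rfl))

theorem defines_dual_iff
    (hC : ∀ (D : Type u) (h : LinearOrder D), C D h → C Dᵒᵈ inferInstance) {r : Rel} :
    Defines C (Rel.dual ⁻¹' S) r ↔ Defines C S r.dual := by
  constructor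
  · intro h
    have := h.dual hC
    rwa [← Set.preimage_comp, show Rel.dual ∘ Rel.dual = id from funext Rel.dual_dual,
      Set.preimage_id] at this
  · intro h
    simpa using h.dual hC

end Duality

/-! ### Invariance of definable relations under surjections. -/

section Preservation

/-- The maps `f` on points and `g` on intervals preserve and reflect the relation `r`. -/
def Preserves {D : Type u} {E : Type v} [LinearOrder D] [LinearOrder E] (f : D → E)
    (g : Ivl D → Ivl E) : Rel → Prop
  | .pp r => ∀ x y, r.Holds (f x) (f y) ↔ r.Holds x y
  | .ip r => ∀ I x, r.Holds (g I) (f x) ↔ r.Holds I x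
  | .ii r => ∀ I J, r.Holds (g I) (g J) ↔ r.Holds I J

variable {D : Type u} {E : Type v} [LinearOrder D] [LinearOrder E] {f : D → E} {g : Ivl D → Ivl E}

/-- Surjectivity carries the quantifiers. Injectivity is not needed because equality is an atom only
when it belongs to S, and `f` and `g` need not be related. -/
theorem Formula.holds_comp {S : Set Rel} (hf : Function.Surjective f) (hg : Function.Surjective g)
    (h : ∀ r ∈ S, Preserves f g r) {m n : ℕ} (φ : Formula S m n) (p : Fin m → D)
    (q : Fin n → Ivl D) : φ.Holds (f ∘ p) (g ∘ q) ↔ φ.Holds p q := by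
  have hc : ∀ {α : Type u} {β : Type v} {k : ℕ} (f : α → β) (a : α) (p : Fin k → α),
      Matrix.vecCons (f a) (f ∘ p) = f ∘ Matrix.vecCons a p := by
    intro α β k f a p
    funext i
    refine Fin.cases ?_ (fun j => ?_) i <;> simp
  induction φ with
  | falsum => rfl
  | atomPP r hr x y => exact h _ hr _ _
  | atomIP r hr x y => exact h _ hr _ _
  | atomII r hr x y => exact h _ hr _ _
  | imp φ ψ ihφ ihψ => simp [ihφ, ihψ]
  | allP φ ih => simp only [holds_allP, hf.forall, hc, ih]
  | allI φ ih => simp only [holds_allI, hg.forall, hc, ih]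

/-- The interval of `ULift D` above an interval of `D`. -/
def Ivl.up {D : Type} [LinearOrder D] (I : Ivl D) : Ivl (ULift.{u} D) :=
  ⟨⟨I.lo⟩, ⟨I.hi⟩, I.lo_lt_hi⟩

/-- The interval of `D` below an interval of `ULift D`. -/
def Ivl.down {D : Type} [LinearOrder D] (I : Ivl (ULift.{u} D)) : Ivl D :=
  ⟨I.lo.down, I.hi.down, I.lo_lt_hi⟩

theorem Formula.holds_down {S : Set Rel} {D : Type} [LinearOrder D] {m n : ℕ}
    (φ : Formula S m n) (p : Fin m → ULift.{u} D) (q : Fin n → Ivl (ULift.{u} D)) :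
    φ.Holds (ULift.down ∘ p) (Ivl.down ∘ q) ↔ φ.Holds p q := by
  refine φ.holds_comp ULift.down_surjective (fun I => ⟨I.up, rfl⟩) ?_ p q
  rintro (r | r | r) - <;> intro x y <;> cases r <;>
    simp [PRel.Holds, MRel.Holds, IRel.Holds, Ivl.down, Ivl.eq_iff]

theorem PRel.holds_up {D : Type} [LinearOrder D] (r : PRel) (x y : D) :
    r.Holds (ULift.up.{u} x) (ULift.up y) ↔ r.Holds x y := by
  cases r <;> simp [PRel.Holds]

theorem MRel.holds_up {D : Type} [LinearOrder D] (r : MRel) (I : Ivl D) (x : D) :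
    r.Holds (Ivl.up.{u} I) (ULift.up x) ↔ r.Holds I x := by
  cases r <;> simp [MRel.Holds, Ivl.up]

theorem IRel.holds_up {D : Type} [LinearOrder D] (r : IRel) (I J : Ivl D) :
    r.Holds (Ivl.up.{u} I) (Ivl.up J) ↔ r.Holds I J := by
  cases r <;> simp [IRel.Holds, Ivl.up, Ivl.eq_iff]

/-- The counterexamples live in `Type` while the classes range over `Type u`, hence the passage
through `ULift`. -/
theorem preserves_of_defines {C : OrderClass.{u}} {S : Set Rel} {D : Type} [LinearOrder D]
    (hD : C (ULift.{u} D) inferInstance) {f : D → D} {g : Ivl D → Ivl D}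
    (hf : Function.Surjective f) (hg : Function.Surjective g)
    (h : ∀ r ∈ S, Preserves f g r) {r : Rel} (hr : Defines C S r) : Preserves f g r := by
  have key : ∀ {m n : ℕ} (φ : Formula S m n) (p : Fin m → D) (q : Fin n → Ivl D),
      φ.Holds p q ↔ φ.Holds (ULift.up.{u} ∘ p) (Ivl.up.{u} ∘ q) :=
    fun φ p q => φ.holds_down (ULift.up.{u} ∘ p) (Ivl.up.{u} ∘ q)
  cases r with
  | pp r =>
    obtain ⟨φ, hφ⟩ := hr
    have h' : ∀ x y : D, φ.Holds ![x, y] ![] ↔ r.Holds x y := fun x y => by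
      rw [key, ← r.holds_up, ← hφ _ hD]
      exact iff_of_eq (congrArg₂ _ (by funext i; fin_cases i <;> rfl) (Subsingleton.elim _ _))
    intro x y
    rw [← h', ← h', ← φ.holds_comp hf hg h ![x, y] ![]]
    exact iff_of_eq (congrArg₂ _ (by funext i; fin_cases i <;> rfl) (Subsingleton.elim _ _))
  | ip r =>
    obtain ⟨φ, hφ⟩ := hr
    have h' : ∀ (I : Ivl D) (x : D), φ.Holds ![x] ![I] ↔ r.Holds I x := fun x y => by
      rw [key, ← r.holds_up, ← hφ _ hD]
      exact iff_of_eq (congrArg₂ _ (by funext i; fin_cases i; rfl) (by funext i; fin_cases i; rfl))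
    intro x y
    rw [← h', ← h', ← φ.holds_comp hf hg h ![y] ![x]]
    exact iff_of_eq (congrArg₂ _ (by funext i; fin_cases i; rfl) (by funext i; fin_cases i; rfl))
  | ii r =>
    obtain ⟨φ, hφ⟩ := hr
    have h' : ∀ I J : Ivl D, φ.Holds ![] ![I, J] ↔ r.Holds I J := fun x y => by
      rw [key, ← r.holds_up, ← hφ _ hD]
      exact iff_of_eq (congrArg₂ _ (Subsingleton.elim _ _) (by funext i; fin_cases i <;> rfl))
    intro x y
    rw [← h', ← h', ← φ.holds_comp hf hg h ![] ![x, y]]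
    exact iff_of_eq (congrArg₂ _ (Subsingleton.elim _ _) (by funext i; fin_cases i <;> rfl))

end Preservation

end PointInterval

/-! ### Complete sets: endpoint relations. -/

namespace PointInterval
open Formula

/-- Classes of dense or unbounded linear orders that are closed under order reversal. -/
structure OrderClass.Admissible (C : OrderClass.{u}) : Prop where
  den_or_unb : ∀ (D : Type u) (h : LinearOrder D), C D h → Den D h ∨ Unb D h
  dual : ∀ (D : Type u) (h : LinearOrder D), C D h → C Dᵒᵈ inferInstance

theorem den_admissible : Den.{u}.Admissible where
  den_or_unb _ _ h := .inl h
  dual _ _ h a b hab := by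
    obtain ⟨c, h₁, h₂⟩ := h (OrderDual.ofDual b) (OrderDual.ofDual a) hab
    exact ⟨OrderDual.toDual c, h₂, h₁⟩

theorem unb_admissible : Unb.{u}.Admissible where
  den_or_unb _ _ h := .inr h
  dual _ _ h a := ⟨(h (OrderDual.ofDual a)).2, (h (OrderDual.ofDual a)).1⟩

variable {C : OrderClass.{u}} {S : Set Rel}

theorem isComplete_of_lt_ip1_ip3 (hl : Defines C S .lt) (h1 : Defines C S .ip1)
    (h3 : Defines C S .ip3) : IsComplete C RPlus S := by
  intro r _
  have he : Defines C S .eqp := .of_closure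
    ⟨conj (neg (defPP hl 0 1)) (neg (defPP hl 1 0)), fun D _ _ x y => by
      simp [PRel.Holds, le_antisymm_iff, and_comm]⟩
  -- It suffices to express an interval relation through the four endpoints, which `ip1` and `ip3`
  -- single out. In `θ` the point variables 0, 1, 2, 3 stand for `J.hi`, `J.lo`, `I.hi`, `I.lo`.
  have hii : ∀ r : IRel, (∃ θ : Formula (definableClosure C S) 4 2, ∀ (D : Type u) [LinearOrder D]
      (I J : Ivl D), θ.Holds ![J.hi, J.lo, I.hi, I.lo] ![I, J] ↔ r.Holds I J) →
      Defines C S (.ii r) := by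
    rintro r ⟨θ, hθ⟩
    refine .of_closure ⟨exP (exP (exP (exP (conj (conj (defIP h1 0 3) (defIP h3 0 2))
      (conj (conj (defIP h1 1 1) (defIP h3 1 0)) θ))))), fun D _ _ I J => ?_⟩
    simp [MRel.Holds, ← hθ, and_assoc]
  rcases r with r | r | r
  · cases r
    · exact hl
    · exact he
  · cases r
    · exact .of_closure ⟨exP (conj (defIP h1 0 0) (defPP hl 1 0)), fun D _ _ I x => by
        simp [MRel.Holds, PRel.Holds]⟩
    · exact h1
    · exact .of_closure ⟨exP (exP (conj (conj (defIP h1 0 0) (defIP h3 0 1))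
        (conj (defPP hl 0 2) (defPP hl 2 1)))), fun D _ _ I x => by
        simp [MRel.Holds, PRel.Holds, and_assoc]⟩
    · exact h3
    · exact .of_closure ⟨exP (conj (defIP h3 0 0) (defPP hl 0 1)), fun D _ _ I x => by
        simp [MRel.Holds, PRel.Holds]⟩
  · apply hii
    cases r
    · exact ⟨conj (defPP he 3 1) (defPP he 2 0), fun D _ I J => by
        simp [PRel.Holds, IRel.Holds, Ivl.eq_iff]⟩
    · exact ⟨defPP he 2 1, fun D _ I J => by simp [PRel.Holds, IRel.Holds]⟩
    · exact ⟨conj (defPP he 3 1) (defPP hl 2 0), fun D _ I J => by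
        simp [PRel.Holds, IRel.Holds]⟩
    · exact ⟨conj (defPP hl 1 3) (defPP he 2 0), fun D _ I J => by
        simp [PRel.Holds, IRel.Holds]⟩
    · exact ⟨conj (defPP hl 1 3) (defPP hl 2 0), fun D _ I J => by
        simp [PRel.Holds, IRel.Holds]⟩
    · exact ⟨conj (defPP hl 3 1) (conj (defPP hl 1 2) (defPP hl 2 0)),
        fun D _ I J => by simp [PRel.Holds, IRel.Holds]⟩
    · exact ⟨defPP hl 2 1, fun D _ I J => by simp [PRel.Holds, IRel.Holds]⟩

/-- x < y iff some interval starts in (x, y]. In an unbounded order it may start at y; in a dense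
order y may be the greatest point, so it starts strictly between. -/
theorem defines_lt_of_ip0 (hC : C.Admissible) (h0 : Defines C S .ip0) : Defines C S .lt := by
  refine .of_closure ⟨exI (conj (defIP h0 0 0) (neg (defIP h0 0 1))),
    fun D _ hD x y => ?_⟩
  simp only [holds_exI, holds_conj, holds_neg, holds_defIP, MRel.Holds, PRel.Holds]
  constructor
  · rintro ⟨I, h₁, h₂⟩
    exact h₁.trans_le (not_lt.1 h₂)
  · intro hxy
    replace hxy : x < y := hxy
    rcases hC.den_or_unb D _ hD with hD | hD
    · obtain ⟨c, h₁, h₂⟩ := hD x y hxy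
      exact ⟨⟨c, y, h₂⟩, h₁, not_lt.2 h₂.le⟩
    · obtain ⟨c, h₁⟩ := (hD y).1
      exact ⟨⟨y, c, h₁⟩, hxy, lt_irrefl y⟩

/-- The left endpoint is the least point at which `ip0` fails. -/
theorem defines_ip1_of_ip0 (hC : C.Admissible) (h0 : Defines C S .ip0) : Defines C S .ip1 := by
  have hl := defines_lt_of_ip0 hC h0
  refine .of_closure ⟨conj (neg (defIP h0 0 0))
    (allP (imp (defPP hl 0 1) (defIP h0 0 0))), fun D _ _ I x => ?_⟩
  simp only [holds_conj, holds_neg, holds_defIP, holds_allP, holds_imp, holds_defPP, MRel.Holds,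
    PRel.Holds]
  constructor
  · rintro ⟨h₁, h₂⟩
    exact le_antisymm (not_lt.1 fun h => lt_irrefl _ (h₂ I.lo h)) (not_lt.1 h₁)
  · intro h
    replace h : x = I.lo := h
    subst h
    exact ⟨lt_irrefl _, fun a h => h⟩

theorem defines_ip3_of_ip4 (hC : C.Admissible) (h4 : Defines C S .ip4) : Defines C S .ip3 :=
  (defines_dual_iff hC.dual (r := .ip1)).1
    (defines_ip1_of_ip0 hC ((defines_dual_iff hC.dual (r := .ip0)).2 h4))

/-- The order is definable from `ip1` together with its restriction to non-maximal second
arguments. -/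
theorem defines_lt_of_ip1 (h1 : Defines C S .ip1) (φ : Formula (definableClosure C S) 2 0)
    (hφ : ∀ (D : Type u) [h : LinearOrder D], C D h → ∀ x y : D,
      φ.Holds ![x, y] ![] ↔ x < y ∧ ∃ z, y < z) : Defines C S .lt := by
  -- The second disjunct covers a greatest y: such a y starts no interval, whereas every point below
  -- it starts one.
  refine .of_closure ⟨disj φ (conj (exI (neg (imp (defIP h1 0 0) (defIP h1 0 1))))
    (neg (exI (defIP h1 0 1)))), fun D _ hD x y => ?_⟩
  simp only [holds_disj, hφ D hD, holds_exI, holds_conj, holds_neg, holds_imp, holds_defIP,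
    MRel.Holds, PRel.Holds]
  show _ ∨ (∃ I : Ivl D, ¬ (x = I.lo → y = I.lo)) ∧ (¬ ∃ I : Ivl D, y = I.lo) ↔ x < y
  constructor
  · rintro (h | ⟨⟨I, h₁⟩, h₂⟩)
    · exact h.1
    · refine lt_of_not_ge fun h => ?_
      obtain ⟨rfl, h₁⟩ := Classical.not_imp.1 h₁
      exact h₂ ⟨⟨y, I.hi, h.trans_lt I.lo_lt_hi⟩, rfl⟩
  · intro h
    by_cases hy : ∃ z, y < z
    · exact .inl ⟨h, hy⟩
    · exact .inr ⟨⟨⟨x, y, h⟩, fun h' => h.ne' (h' rfl)⟩, fun ⟨I, hI⟩ => hy ⟨I.hi, hI ▸ I.lo_lt_hi⟩⟩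

theorem isComplete_of_ip1_ip3 (h1 : Defines C S .ip1) (h3 : Defines C S .ip3) :
    IsComplete C RPlus S := by
  refine isComplete_of_lt_ip1_ip3 (.of_closure
    ⟨exI (conj (defIP h1 0 0) (defIP h3 0 1)), fun D _ _ x y => ?_⟩) h1 h3
  simp only [holds_exI, holds_conj, holds_defIP, MRel.Holds, PRel.Holds]
  show (∃ I : Ivl D, x = I.lo ∧ y = I.hi) ↔ x < y
  exact ⟨fun ⟨I, h₁, h₂⟩ => h₁ ▸ h₂ ▸ I.lo_lt_hi, fun h => ⟨⟨x, y, h⟩, rfl, rfl⟩⟩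

/-- The right endpoint is the first point above the left endpoint that is not interior. -/
theorem isComplete_of_ip1_ip2 (h1 : Defines C S .ip1) (h2 : Defines C S .ip2) :
    IsComplete C RPlus S := by
  have hl : Defines C S .lt := by
    refine defines_lt_of_ip1 h1 (exI (conj (defIP h1 0 0) (defIP h2 0 1)))
      fun D _ _ x y => ?_
    simp only [holds_exI, holds_conj, holds_defIP, MRel.Holds]
    show (∃ I : Ivl D, x = I.lo ∧ I.lo < y ∧ y < I.hi) ↔ _
    constructor
    · rintro ⟨I, rfl, h₁, h₂⟩
      exact ⟨h₁, _, h₂⟩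
    · rintro ⟨h, z, hz⟩
      exact ⟨⟨x, z, h.trans hz⟩, rfl, h, hz⟩
  refine isComplete_of_ip1_ip3 h1 (.of_closure ⟨exP (conj (conj (defIP h1 0 0)
    (conj (defPP hl 0 1) (neg (defIP h2 0 1)))) (allP (imp (defPP hl 1 0)
    (imp (defPP hl 0 2) (defIP h2 0 0))))), fun D _ _ I x => ?_⟩)
  simp only [holds_exP, holds_allP, holds_imp, holds_neg, holds_conj, holds_defIP, holds_defPP,
    MRel.Holds, PRel.Holds]
  show (∃ a, (a = I.lo ∧ a < x ∧ ¬ (I.lo < x ∧ x < I.hi)) ∧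
    ∀ y, a < y → y < x → I.lo < y ∧ y < I.hi) ↔ x = I.hi
  constructor
  · rintro ⟨a, ⟨rfl, h₁, h₂⟩, h₃⟩
    refine le_antisymm (not_lt.1 fun h => ?_) (not_lt.1 fun h => h₂ ⟨h₁, h⟩)
    exact lt_irrefl _ (h₃ _ I.lo_lt_hi h).2
  · rintro rfl
    exact ⟨_, ⟨rfl, I.lo_lt_hi, fun h => lt_irrefl _ h.2⟩, fun y h₁ h₂ => ⟨h₁, h₂⟩⟩

theorem isComplete_of_ip1_ip4 (hC : C.Admissible) (h1 : Defines C S .ip1)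
    (h4 : Defines C S .ip4) : IsComplete C RPlus S :=
  isComplete_of_ip1_ip3 h1 (defines_ip3_of_ip4 hC h4)

/-- Any interval met by `I` starts at the right endpoint of `I`. If there is none, that endpoint is
the greatest point, which is the only point starting no interval. -/
theorem isComplete_of_ip1_meets (h1 : Defines C S .ip1) (h : Defines C S .ii34) :
    IsComplete C RPlus S := by
  refine isComplete_of_ip1_ip3 h1 (.of_closure ⟨disj
    (exI (conj (defII h 1 0) (defIP h1 0 0)))
    (conj (neg (exI (defII h 1 0))) (neg (exI (defIP h1 0 0)))),
    fun D _ _ I x => ?_⟩)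
  simp only [holds_disj, holds_exI, holds_neg, holds_conj, holds_defIP, holds_defII,
    MRel.Holds, IRel.Holds]
  show (∃ J : Ivl D, I.hi = J.lo ∧ x = J.lo) ∨ (¬ ∃ J : Ivl D, I.hi = J.lo) ∧
    (¬ ∃ J : Ivl D, x = J.lo) ↔ x = I.hi
  constructor
  · rintro (⟨J, h₁, h₂⟩ | ⟨h₁, h₂⟩)
    · exact h₂.trans h₁.symm
    · rcases lt_trichotomy x I.hi with h' | h' | h'
      · exact (h₂ ⟨⟨x, I.hi, h'⟩, rfl⟩).elim
      · exact h'
      · exact (h₁ ⟨⟨I.hi, x, h'⟩, rfl⟩).elim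
  · rintro rfl
    by_cases h' : ∃ J : Ivl D, I.hi = J.lo
    · obtain ⟨J, hJ⟩ := h'
      exact .inl ⟨J, hJ, hJ⟩
    · exact .inr ⟨h', h'⟩

/-- A point after `I` starts an interval after `I`, unless it is the greatest point; density then
still provides some interval after `I`. -/
theorem isComplete_of_ip1_before (hC : C.Admissible) (h1 : Defines C S .ip1)
    (h : Defines C S .ii44) : IsComplete C RPlus S := by
  refine isComplete_of_ip1_ip4 hC h1 (.of_closure ⟨disj
    (exI (conj (defII h 1 0) (defIP h1 0 0)))
    (conj (exI (defII h 1 0)) (neg (exI (defIP h1 0 0)))),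
    fun D _ hD I x => ?_⟩)
  simp only [holds_disj, holds_exI, holds_neg, holds_conj, holds_defIP, holds_defII,
    MRel.Holds, IRel.Holds]
  show (∃ J : Ivl D, I.hi < J.lo ∧ x = J.lo) ∨ (∃ J : Ivl D, I.hi < J.lo) ∧
    (¬ ∃ J : Ivl D, x = J.lo) ↔ I.hi < x
  constructor
  · rintro (⟨J, h₁, rfl⟩ | ⟨⟨J, h₁⟩, h₂⟩)
    · exact h₁
    · exact h₁.trans (J.lo_lt_hi.trans_le (not_lt.1 fun h' => h₂ ⟨⟨x, J.hi, h'⟩, rfl⟩))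
  · intro hx
    by_cases h' : ∃ J : Ivl D, x = J.lo
    · obtain ⟨J, rfl⟩ := h'
      exact .inl ⟨J, hx, rfl⟩
    · refine .inr ⟨?_, h'⟩
      rcases hC.den_or_unb D _ hD with hD | hD
      · obtain ⟨c, h₁, h₂⟩ := hD _ _ hx
        exact ⟨⟨c, x, h₂⟩, h₁⟩
      · obtain ⟨c, h₁⟩ := (hD x).1
        exact (h' ⟨⟨x, c, h₁⟩, rfl⟩).elim

/-- In a dense or unbounded order, every point below another point has two successive points
above it. -/
theorem exists_lt_lt_of_lt (hC : C.Admissible) {D : Type u} [h : LinearOrder D] (hD : C D h)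
    {y z : D} (hz : y < z) : ∃ b d, y < b ∧ b < d := by
  rcases hC.den_or_unb D _ hD with hD | hD
  · obtain ⟨c, h₁, h₂⟩ := hD _ _ hz
    exact ⟨c, z, h₁, h₂⟩
  · obtain ⟨c, h₁⟩ := (hD z).1
    exact ⟨z, c, hz, h₁⟩

/-- If some point lies above `I`, the interior of `I` consists of the starts of the intervals that
`I` overlaps. Otherwise `I` overlaps nothing and ends at the greatest point, and its interior lies
strictly between its start and that point. -/
theorem isComplete_of_ip1_overlaps (hC : C.Admissible) (h1 : Defines C S .ip1)
    (h : Defines C S .ii24) : IsComplete C RPlus S := by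
  have hl : Defines C S .lt := by
    refine defines_lt_of_ip1 h1 (exI (exI (conj (defII h 1 0)
      (conj (defIP h1 1 0) (defIP h1 0 1))))) fun D _ hD x y => ?_
    simp only [holds_exI, holds_conj, holds_defIP, holds_defII, MRel.Holds, IRel.Holds]
    show (∃ I J : Ivl D, (I.lo < J.lo ∧ J.lo < I.hi ∧ I.hi < J.hi) ∧ x = I.lo ∧ y = J.lo) ↔ _
    constructor
    · rintro ⟨I, J, ⟨h₁, h₂, h₃⟩, rfl, rfl⟩
      exact ⟨h₁, _, h₂⟩
    · rintro ⟨hxy, z, hz⟩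
      obtain ⟨b, d, h₁, h₂⟩ := exists_lt_lt_of_lt hC hD hz
      exact ⟨⟨x, b, hxy.trans h₁⟩, ⟨y, d, h₁.trans h₂⟩, ⟨hxy, h₁, h₂⟩, rfl, rfl⟩
  refine isComplete_of_ip1_ip2 h1 (.of_closure ⟨disj
    (exI (conj (defIP h1 0 0) (defII h 1 0)))
    (conj (neg (exI (defII h 1 0))) (exP (conj
      (neg (exI (defIP h1 0 0))) (conj (defPP hl 1 0)
        (exP (conj (defIP h1 0 0) (defPP hl 0 2))))))), fun D _ hD I x => ?_⟩)
  simp only [holds_disj, holds_exI, holds_exP, holds_neg, holds_conj, holds_defIP, holds_defII,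
    holds_defPP, MRel.Holds, IRel.Holds, PRel.Holds]
  show (∃ J : Ivl D, x = J.lo ∧ I.lo < J.lo ∧ J.lo < I.hi ∧ I.hi < J.hi) ∨
    (¬ ∃ J : Ivl D, I.lo < J.lo ∧ J.lo < I.hi ∧ I.hi < J.hi) ∧
      (∃ m, (¬ ∃ J : Ivl D, m = J.lo) ∧ x < m ∧ ∃ a, a = I.lo ∧ a < x) ↔ I.lo < x ∧ x < I.hi
  constructor
  · rintro (⟨J, rfl, h₁, h₂, h₃⟩ | ⟨h₁, m, h₂, h₃, a, rfl, h₄⟩)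
    · exact ⟨h₁, h₂⟩
    · refine ⟨h₄, ?_⟩
      have hm : I.hi ≤ m := not_lt.1 fun h' => h₂ ⟨⟨m, _, h'⟩, rfl⟩
      rcases hm.eq_or_lt with rfl | hm
      · exact h₃
      -- If `I` ended before the greatest point `m`, density would give an interval ending at `m`
      -- that `I` overlaps; an unbounded order has no such `m`.
      · rcases hC.den_or_unb D _ hD with hD | hD
        · obtain ⟨c, h₅, h₆⟩ := hD _ _ I.lo_lt_hi
          exact (h₁ ⟨⟨c, m, h₆.trans hm⟩, h₅, h₆, hm⟩).elim
        · obtain ⟨d, h₅⟩ := (hD m).1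
          exact (h₂ ⟨⟨m, d, h₅⟩, rfl⟩).elim
  · rintro ⟨h₁, h₂⟩
    by_cases h' : ∃ d, I.hi < d
    · obtain ⟨d, hd⟩ := h'
      exact .inl ⟨⟨x, d, h₂.trans hd⟩, rfl, h₁, h₂, hd⟩
    · refine .inr ⟨fun ⟨J, h₃⟩ => h' ⟨_, h₃.2.2⟩, I.hi, ?_, h₂, _, rfl, h₁⟩
      exact fun ⟨J, hJ⟩ => h' ⟨J.hi, hJ ▸ J.lo_lt_hi⟩

theorem isComplete_of_ip1_finishes (h1 : Defines C S .ip1) (h : Defines C S .ii03) :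
    IsComplete C RPlus S := by
  refine isComplete_of_ip1_ip2 h1 (.of_closure ⟨exI (conj (defIP h1 0 0)
    (defII h 0 1)), fun D _ _ I x => ?_⟩)
  simp only [holds_exI, holds_conj, holds_defIP, holds_defII, MRel.Holds, IRel.Holds]
  show (∃ J : Ivl D, x = J.lo ∧ I.lo < J.lo ∧ J.hi = I.hi) ↔ I.lo < x ∧ x < I.hi
  constructor
  · rintro ⟨J, rfl, h₁, h₂⟩
    exact ⟨h₁, h₂ ▸ J.lo_lt_hi⟩
  · rintro ⟨h₁, h₂⟩
    exact ⟨⟨x, I.hi, h₂⟩, rfl, h₁, rfl⟩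

theorem isComplete_den_of_ip1_during (h1 : Defines Den.{u} S .ip1)
    (h : Defines Den.{u} S .ii04) : IsComplete Den.{u} RPlus S := by
  refine isComplete_of_ip1_ip2 h1 (.of_closure ⟨exI (conj (defIP h1 0 0)
    (defII h 0 1)), fun D _ hD I x => ?_⟩)
  simp only [holds_exI, holds_conj, holds_defIP, holds_defII, MRel.Holds, IRel.Holds]
  show (∃ J : Ivl D, x = J.lo ∧ I.lo < J.lo ∧ J.hi < I.hi) ↔ I.lo < x ∧ x < I.hi
  constructor
  · rintro ⟨J, rfl, h₁, h₂⟩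
    exact ⟨h₁, J.lo_lt_hi.trans h₂⟩
  · rintro ⟨h₁, h₂⟩
    obtain ⟨c, h₃, h₄⟩ := hD _ _ h₂
    exact ⟨⟨x, c, h₃⟩, rfl, h₁, h₄⟩

/-- Without density an interior point of `I` need not start an interval strictly inside `I`. Instead
`ii04` is used to compare right endpoints, and x lies after `I` iff some y < x starts only intervals
that end after `I`, which means `I.hi` ≤ y. -/
theorem isComplete_unb_of_ip1_during (h1 : Defines Unb.{u} S .ip1)
    (h : Defines Unb.{u} S .ii04) : IsComplete Unb.{u} RPlus S := by
  have hl : Defines Unb.{u} S .lt := by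
    refine defines_lt_of_ip1 h1 (exI (exI (conj (defII h 0 1)
      (conj (defIP h1 1 0) (defIP h1 0 1))))) fun D _ hD x y => ?_
    simp only [holds_exI, holds_conj, holds_defIP, holds_defII, MRel.Holds, IRel.Holds]
    show (∃ I J : Ivl D, (I.lo < J.lo ∧ J.hi < I.hi) ∧ x = I.lo ∧ y = J.lo) ↔ _
    constructor
    · rintro ⟨I, J, ⟨h₁, h₂⟩, rfl, rfl⟩
      exact ⟨h₁, _, J.lo_lt_hi⟩
    · rintro ⟨hxy, z, hz⟩
      obtain ⟨b, d, h₁, h₂⟩ := exists_lt_lt_of_lt unb_admissible hD hz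
      exact ⟨⟨x, d, hxy.trans (h₁.trans h₂)⟩, ⟨y, b, h₁⟩, ⟨hxy, h₂⟩, rfl, rfl⟩
  obtain ⟨φ, hφ⟩ : ∃ φ : Formula (definableClosure Unb.{u} S) 0 2, ∀ (D : Type u)
      [h : LinearOrder D], Unb D h → ∀ I J : Ivl D, φ.Holds ![] ![I, J] ↔ I.hi ≤ J.hi := by
    -- `I.hi` ≤ `J.hi` iff every interval that strictly surrounds `J` and starts before `I` also
    -- strictly surrounds `I`. If `J.hi` < `I.hi`, an interval starting before both and ending at
    -- `I.hi` is a counterexample.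
    refine ⟨allI (imp (defII h 2 0) (imp (exP (exP (conj (defPP hl 0 1)
      (conj (defIP h1 0 0) (defIP h1 1 1))))) (defII h 1 0))),
      fun D _ hD I J => ?_⟩
    simp only [holds_allI, holds_imp, holds_exP, holds_conj, holds_defIP, holds_defII,
      holds_defPP, MRel.Holds, IRel.Holds, PRel.Holds]
    show (∀ K : Ivl D, K.lo < J.lo ∧ J.hi < K.hi → (∃ x y, y < x ∧ y = K.lo ∧ x = I.lo) →
      K.lo < I.lo ∧ I.hi < K.hi) ↔ I.hi ≤ J.hi
    constructor
    · intro h'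
      refine not_lt.1 fun hlt => ?_
      obtain ⟨c, hc⟩ := (hD (min I.lo J.lo)).2
      obtain ⟨h₁, h₂⟩ := lt_min_iff.1 hc
      exact lt_irrefl _ (h' ⟨c, I.hi, h₁.trans I.lo_lt_hi⟩ ⟨h₂, hlt⟩ ⟨_, _, h₁, rfl, rfl⟩).2
    · rintro h' K ⟨h₁, h₂⟩ ⟨x, y, h₃, rfl, rfl⟩
      exact ⟨h₃, h'.trans_lt h₂⟩
  refine isComplete_of_ip1_ip4 unb_admissible h1 (.of_closure ⟨exP (conj (defPP hl 0 1)
    (allI (imp (defIP h1 0 0) (neg (φ.appII 0 1))))), fun D _ hD I x => ?_⟩)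
  simp only [holds_allI, holds_imp, holds_exP, holds_neg, holds_conj, holds_defIP, holds_defPP,
    holds_appII, MRel.Holds, PRel.Holds]
  show (∃ y, y < x ∧ ∀ K : Ivl D, y = K.lo → ¬ φ.Holds ![] ![K, I]) ↔ I.hi < x
  simp only [hφ D hD, not_le]
  constructor
  · rintro ⟨y, h₁, h₂⟩
    refine lt_of_le_of_lt (not_lt.1 fun h' => ?_) h₁
    exact lt_irrefl _ (h₂ ⟨y, I.hi, h'⟩ rfl)
  · intro hx
    exact ⟨I.hi, hx, fun K hK => hK ▸ K.lo_lt_hi⟩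

/-! ### Complete sets: endpoints recovered from interiors. -/

/-- By density interior points accumulate at the left endpoint, which is therefore the greatest
strict lower bound of the interior. -/
theorem isComplete_den_of_ip2_lt (h2 : Defines Den.{u} S .ip2) (hl : Defines Den.{u} S .lt) :
    IsComplete Den.{u} RPlus S := by
  refine isComplete_of_ip1_ip2 (.of_closure ⟨conj
    (allP (imp (defIP h2 0 0) (defPP hl 1 0)))
    (allP (imp (defPP hl 1 0) (exP (conj (defIP h2 0 0) (neg (defPP hl 1 0)))))),
    fun D _ hD I x => ?_⟩) h2
  simp only [holds_conj, holds_allP, holds_imp, holds_exP, holds_neg, holds_defIP, holds_defPP,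
    MRel.Holds, PRel.Holds]
  show (∀ y, I.lo < y ∧ y < I.hi → x < y) ∧
    (∀ z, x < z → ∃ y, (I.lo < y ∧ y < I.hi) ∧ ¬ z < y) ↔ x = I.lo
  constructor
  · rintro ⟨h₁, h₂⟩
    refine le_antisymm (not_lt.1 fun h' => ?_) (not_lt.1 fun h' => ?_)
    · obtain ⟨y, h₃, h₄⟩ := hD _ _ I.lo_lt_hi
      by_cases hx : x < I.hi
      · exact lt_irrefl _ (h₁ x ⟨h', hx⟩)
      · exact hx ((h₁ y ⟨h₃, h₄⟩).trans h₄)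
    · obtain ⟨y, h₃, h₄⟩ := h₂ _ h'
      exact h₄ h₃.1
  · rintro rfl
    refine ⟨fun y hy => hy.1, fun z hz => ?_⟩
    obtain ⟨y, h₁, h₂⟩ := hD _ _ (lt_min hz I.lo_lt_hi)
    obtain ⟨h₃, h₄⟩ := lt_min_iff.1 h₂
    exact ⟨y, ⟨h₁, h₄⟩, h₃.not_gt⟩

/-- Over unbounded orders `ip2` defines betweenness of points, hence it defines the order as soon
as it can express any cofinal part of it. -/
theorem defines_lt_unb_of_ip2 (h2 : Defines Unb.{u} S .ip2)
    (φ : Formula (definableClosure Unb.{u} S) 2 0)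
    (hφ : ∀ (D : Type u) [h : LinearOrder D], Unb D h → (∀ x z : D, φ.Holds ![x, z] ![] → x < z) ∧
      ∀ x y : D, x < y → ∃ z, y < z ∧ φ.Holds ![x, z] ![]) : Defines Unb.{u} S .lt := by
  -- The first conjunct expresses x ≠ y. The second finds z with φ(x, z), hence x < z, such that y
  -- belongs to every interval interior containing x and z; if y < x, an interval starting at y and
  -- ending beyond z violates this.
  refine .of_closure ⟨conj (exI (conj (defIP h2 0 0) (neg (defIP h2 0 1)))) (exP (conj
    (φ.appPP 1 0) (allI (imp (defIP h2 0 1) (imp (defIP h2 0 0) (defIP h2 0 2)))))),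
    fun D _ hD x y => ?_⟩
  obtain ⟨hφ₁, hφ₂⟩ := hφ D hD
  simp only [holds_conj, holds_allI, holds_imp, holds_exP, holds_exI, holds_neg, holds_defIP,
    holds_appPP, MRel.Holds, PRel.Holds]
  show (∃ I : Ivl D, (I.lo < x ∧ x < I.hi) ∧ ¬ (I.lo < y ∧ y < I.hi)) ∧
    (∃ z, φ.Holds ![x, z] ![] ∧ ∀ I : Ivl D, I.lo < x ∧ x < I.hi → I.lo < z ∧ z < I.hi →
      I.lo < y ∧ y < I.hi) ↔ x < y
  constructor
  · rintro ⟨⟨I, h₁, h₂⟩, z, hz, h₃⟩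
    rcases lt_trichotomy x y with h | rfl | h
    · exact h
    · exact (h₂ h₁).elim
    · have hxz := hφ₁ x z hz
      obtain ⟨w, hw⟩ := (hD z).1
      have := h₃ ⟨y, w, h.trans (hxz.trans hw)⟩ ⟨h, hxz.trans hw⟩ ⟨h.trans hxz, hw⟩
      exact (lt_irrefl _ this.1).elim
  · intro h
    obtain ⟨w, hw⟩ := (hD x).2
    obtain ⟨z, hyz, hz⟩ := hφ₂ x y h
    exact ⟨⟨⟨w, y, hw.trans h⟩, ⟨hw, h⟩, fun h' => lt_irrefl _ h'.2⟩, z, hz,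
      fun I h₁ h₂ => ⟨h₁.1.trans h, hyz.trans h₂.2⟩⟩

/-- The right endpoint is the least strict upper bound of a nonempty interior; strictness matters in
discrete orders. Intervals with empty interior are excluded because `ip2` cannot distinguish them.
-/
theorem exists_formula_eq_hi (h2 : Defines C S .ip2) (hl : Defines C S .lt) :
    ∃ φ : Formula (definableClosure C S) 1 1, ∀ (D : Type u) [LinearOrder D] (I : Ivl D) (x : D),
      φ.Holds ![x] ![I] ↔ (∃ y, I.lo < y ∧ y < I.hi) ∧ x = I.hi := by
  refine ⟨conj (exP (defIP h2 0 0)) (conj (allP (imp (defIP h2 0 0) (defPP hl 0 1)))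
    (allP (imp (defPP hl 0 1) (exP (conj (defIP h2 0 0) (neg (defPP hl 0 1))))))),
    fun D _ I x => ?_⟩
  simp only [holds_conj, holds_allP, holds_imp, holds_exP, holds_neg, holds_defIP, holds_defPP,
    MRel.Holds, PRel.Holds]
  show (∃ y, I.lo < y ∧ y < I.hi) ∧ (∀ y, I.lo < y ∧ y < I.hi → y < x) ∧
    (∀ z, z < x → ∃ y, (I.lo < y ∧ y < I.hi) ∧ ¬ y < z) ↔ _
  refine and_congr_right ?_
  rintro ⟨w, hw₁, hw₂⟩
  constructor
  · rintro ⟨h₁, h₂⟩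
    refine le_antisymm (not_lt.1 fun h' => ?_) (not_lt.1 fun h' => ?_)
    · obtain ⟨y, h₃, h₄⟩ := h₂ _ h'
      exact h₄ h₃.2
    · exact lt_irrefl _ (h₁ x ⟨hw₁.trans (h₁ w ⟨hw₁, hw₂⟩), h'⟩)
  · rintro rfl
    refine ⟨fun y hy => hy.2, fun z hz => ?_⟩
    by_cases hz' : I.lo < z
    · exact ⟨z, ⟨hz', hz⟩, lt_irrefl _⟩
    · exact ⟨w, ⟨hw₁, hw₂⟩, fun h => hz' (hw₁.trans h)⟩

theorem exists_formula_eq_lo (h2 : Defines C S .ip2) (hl : Defines C S .lt) :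
    ∃ φ : Formula (definableClosure C S) 1 1, ∀ (D : Type u) [LinearOrder D] (I : Ivl D) (x : D),
      φ.Holds ![x] ![I] ↔ (∃ y, I.lo < y ∧ y < I.hi) ∧ x = I.lo := by
  refine ⟨conj (exP (defIP h2 0 0)) (conj (allP (imp (defIP h2 0 0) (defPP hl 1 0)))
    (allP (imp (defPP hl 1 0) (exP (conj (defIP h2 0 0) (neg (defPP hl 1 0))))))),
    fun D _ I x => ?_⟩
  simp only [holds_conj, holds_allP, holds_imp, holds_exP, holds_neg, holds_defIP, holds_defPP,
    MRel.Holds, PRel.Holds]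
  show (∃ y, I.lo < y ∧ y < I.hi) ∧ (∀ y, I.lo < y ∧ y < I.hi → x < y) ∧
    (∀ z, x < z → ∃ y, (I.lo < y ∧ y < I.hi) ∧ ¬ z < y) ↔ _
  refine and_congr_right ?_
  rintro ⟨w, hw₁, hw₂⟩
  constructor
  · rintro ⟨h₁, h₂⟩
    refine le_antisymm (not_lt.1 fun h' => ?_) (not_lt.1 fun h' => ?_)
    · exact lt_irrefl _ (h₁ x ⟨h', (h₁ w ⟨hw₁, hw₂⟩).trans hw₂⟩)
    · obtain ⟨y, h₃, h₄⟩ := h₂ _ h'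
      exact h₄ h₃.1
  · rintro rfl
    refine ⟨fun y hy => hy.1, fun z hz => ?_⟩
    by_cases hz' : z < I.hi
    · exact ⟨z, ⟨hz, hz'⟩, lt_irrefl _⟩
    · exact ⟨w, ⟨hw₁, hw₂⟩, fun h => hz' (h.trans hw₂)⟩

/-- Two meeting intervals order their interior points. As there is no least point, every point ends
an interval with nonempty interior, so the start of `I` is found as the end of such an interval
meeting `I`. -/
theorem isComplete_unb_of_ip2_meets (h2 : Defines Unb.{u} S .ip2) (h : Defines Unb.{u} S .ii34) :
    IsComplete Unb.{u} RPlus S := by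
  have hl : Defines Unb.{u} S .lt := by
    refine defines_lt_unb_of_ip2 h2 (exI (exI (conj (defII h 1 0)
      (conj (defIP h2 1 0) (defIP h2 0 1))))) fun D _ hD => ?_
    simp only [holds_exI, holds_conj, holds_defIP, holds_defII, MRel.Holds, IRel.Holds]
    constructor
    · rintro x z ⟨I, J, h₁, ⟨h₂, h₃⟩, h₄, h₅⟩
      exact lt_trans h₃ (lt_of_eq_of_lt h₁ h₄)
    · intro x y hxy
      obtain ⟨a, ha⟩ := (hD x).2
      obtain ⟨z, hz⟩ := (hD y).1
      obtain ⟨d, hd⟩ := (hD z).1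
      exact ⟨z, hz, ⟨a, y, ha.trans hxy⟩, ⟨y, d, hz.trans hd⟩, rfl, ⟨ha, hxy⟩, hz, hd⟩
  obtain ⟨φ, hφ⟩ := exists_formula_eq_hi h2 hl
  refine isComplete_of_ip1_ip2 (.of_closure ⟨exI (conj (φ.appIP 0 0) (defII h 0 1)),
    fun D _ hD I x => ?_⟩) h2
  simp only [holds_exI, holds_conj, holds_appIP, holds_defII, hφ, MRel.Holds, IRel.Holds]
  show (∃ J : Ivl D, ((∃ y, J.lo < y ∧ y < J.hi) ∧ x = J.hi) ∧ J.hi = I.lo) ↔ x = I.lo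
  constructor
  · rintro ⟨J, ⟨-, h₁⟩, h₂⟩
    exact h₁.trans h₂
  · rintro rfl
    obtain ⟨b, hb⟩ := (hD I.lo).2
    obtain ⟨a, ha⟩ := (hD b).2
    exact ⟨⟨a, I.lo, ha.trans hb⟩, ⟨⟨b, ha, hb⟩, rfl⟩, rfl⟩

theorem isComplete_unb_of_ip2_before (h2 : Defines Unb.{u} S .ip2) (h : Defines Unb.{u} S .ii44) :
    IsComplete Unb.{u} RPlus S := by
  have hl : Defines Unb.{u} S .lt := by
    refine defines_lt_unb_of_ip2 h2 (exI (exI (conj (defII h 1 0)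
      (conj (defIP h2 1 0) (defIP h2 0 1))))) fun D _ hD => ?_
    simp only [holds_exI, holds_conj, holds_defIP, holds_defII, MRel.Holds, IRel.Holds]
    constructor
    · rintro x z ⟨I, J, h₁, ⟨h₂, h₃⟩, h₄, h₅⟩
      exact lt_trans h₃ (lt_trans h₁ h₄)
    · intro x y hxy
      obtain ⟨a, ha⟩ := (hD x).2
      obtain ⟨c, hc⟩ := (hD y).1
      obtain ⟨z, hz⟩ := (hD c).1
      obtain ⟨d, hd⟩ := (hD z).1
      exact ⟨z, hc.trans hz, ⟨a, y, ha.trans hxy⟩, ⟨c, d, hz.trans hd⟩, hc, ⟨ha, hxy⟩, hz, hd⟩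
  obtain ⟨φ, hφ⟩ := exists_formula_eq_hi h2 hl
  refine isComplete_of_ip1_ip2 (defines_ip1_of_ip0 unb_admissible
    (.of_closure ⟨exI (conj (φ.appIP 0 0) (defII h 0 1)), fun D _ hD I x => ?_⟩)) h2
  simp only [holds_exI, holds_conj, holds_appIP, holds_defII, hφ, MRel.Holds, IRel.Holds]
  show (∃ J : Ivl D, ((∃ y, J.lo < y ∧ y < J.hi) ∧ x = J.hi) ∧ J.hi < I.lo) ↔ x < I.lo
  constructor
  · rintro ⟨J, ⟨-, rfl⟩, h₂⟩
    exact h₂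
  · intro hx
    obtain ⟨b, hb⟩ := (hD x).2
    obtain ⟨a, ha⟩ := (hD b).2
    exact ⟨⟨a, x, ha.trans hb⟩, ⟨⟨b, ha, hb⟩, rfl⟩, hx⟩

/-- A point in the longer interval but outside the shorter one lies above the interior of the
latter. Prolonging `I` to the right makes `I.hi` an interior point, so the left endpoint becomes
visible. -/
theorem isComplete_unb_of_ip2_starts (h2 : Defines Unb.{u} S .ip2) (h : Defines Unb.{u} S .ii14) :
    IsComplete Unb.{u} RPlus S := by
  have hl : Defines Unb.{u} S .lt := by
    refine defines_lt_unb_of_ip2 h2 (exI (exI (conj (defII h 1 0)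
      (conj (defIP h2 1 0) (conj (neg (defIP h2 1 1)) (defIP h2 0 1)))))) fun D _ hD => ?_
    simp only [holds_exI, holds_conj, holds_neg, holds_defIP, holds_defII, MRel.Holds, IRel.Holds]
    constructor
    · rintro x z ⟨I, J, ⟨h₁, h₁'⟩, ⟨h₂, h₃⟩, h₆, h₄, h₅⟩
      exact lt_of_lt_of_le h₃ (not_lt.1 fun h' => h₆ ⟨lt_of_eq_of_lt h₁ h₄, h'⟩)
    · intro x y hxy
      obtain ⟨a, ha⟩ := (hD x).2
      obtain ⟨z, hz⟩ := (hD y).1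
      obtain ⟨d, hd⟩ := (hD z).1
      exact ⟨z, hz, ⟨a, y, ha.trans hxy⟩, ⟨a, d, (ha.trans hxy).trans (hz.trans hd)⟩,
        ⟨rfl, hz.trans hd⟩, ⟨ha, hxy⟩, fun h' => hz.not_gt h'.2, (ha.trans hxy).trans hz, hd⟩
  obtain ⟨φ, hφ⟩ := exists_formula_eq_lo h2 hl
  refine isComplete_of_ip1_ip2 (.of_closure ⟨exI (conj (φ.appIP 0 0) (defII h 1 0)),
    fun D _ hD I x => ?_⟩) h2
  simp only [holds_exI, holds_conj, holds_appIP, holds_defII, hφ, MRel.Holds, IRel.Holds]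
  show (∃ J : Ivl D, ((∃ y, J.lo < y ∧ y < J.hi) ∧ x = J.lo) ∧ I.lo = J.lo ∧ I.hi < J.hi) ↔
    x = I.lo
  constructor
  · rintro ⟨J, ⟨-, h₁⟩, h₂, -⟩
    exact h₁.trans h₂.symm
  · rintro rfl
    obtain ⟨d, hd⟩ := (hD I.hi).1
    exact ⟨⟨I.lo, d, I.lo_lt_hi.trans hd⟩, ⟨⟨I.hi, I.lo_lt_hi, hd⟩, rfl⟩, rfl, hd⟩

/-- For x < `I.lo`, an interval from x to beyond `I.hi` has `I.lo` in its interior, so its left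
endpoint is recognisable. -/
theorem isComplete_unb_of_ip2_during_lt (h2 : Defines Unb.{u} S .ip2)
    (h : Defines Unb.{u} S .ii04) (hl : Defines Unb.{u} S .lt) : IsComplete Unb.{u} RPlus S := by
  obtain ⟨φ, hφ⟩ := exists_formula_eq_lo h2 hl
  refine isComplete_of_ip1_ip2 (defines_ip1_of_ip0 unb_admissible
    (.of_closure ⟨exI (conj (φ.appIP 0 0) (defII h 1 0)), fun D _ hD I x => ?_⟩)) h2
  simp only [holds_exI, holds_conj, holds_appIP, holds_defII, hφ, MRel.Holds, IRel.Holds]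
  show (∃ J : Ivl D, ((∃ y, J.lo < y ∧ y < J.hi) ∧ x = J.lo) ∧ J.lo < I.lo ∧ I.hi < J.hi) ↔
    x < I.lo
  constructor
  · rintro ⟨J, ⟨-, rfl⟩, h₂, -⟩
    exact h₂
  · intro hx
    obtain ⟨d, hd⟩ := (hD I.hi).1
    exact ⟨⟨x, d, (hx.trans I.lo_lt_hi).trans hd⟩, ⟨⟨I.lo, hx, I.lo_lt_hi.trans hd⟩, rfl⟩, hx, hd⟩

theorem isComplete_unb_of_ip2_during_overlaps (h2 : Defines Unb.{u} S .ip2)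
    (h : Defines Unb.{u} S .ii04) (h' : Defines Unb.{u} S .ii24) : IsComplete Unb.{u} RPlus S := by
  refine isComplete_unb_of_ip2_during_lt h2 h ?_
  refine defines_lt_unb_of_ip2 h2 (exI (exI (conj (defII h' 1 0) (conj
    (conj (defIP h2 1 0) (neg (defIP h2 1 1))) (defIP h2 0 1))))) fun D _ hD => ?_
  simp only [holds_exI, holds_conj, holds_neg, holds_defIP, holds_defII, MRel.Holds, IRel.Holds]
  constructor
  · rintro x z ⟨I, J, ⟨h₁, h₁', h₁''⟩, ⟨⟨h₂, h₃⟩, h₄⟩, h₅, h₆⟩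
    exact lt_of_lt_of_le h₃ (not_lt.1 fun h' => h₄ ⟨lt_trans h₁ h₅, h'⟩)
  · intro x y hxy
    obtain ⟨a, ha⟩ := (hD x).2
    obtain ⟨b, hb⟩ := (hD y).1
    obtain ⟨z, hz⟩ := (hD b).1
    obtain ⟨d, hd⟩ := (hD z).1
    have hay := ha.trans hxy
    exact ⟨z, hb.trans hz, ⟨a, b, hay.trans hb⟩, ⟨y, d, hb.trans (hz.trans hd)⟩,
      ⟨hay, hb, hz.trans hd⟩, ⟨⟨ha, hxy.trans hb⟩, fun h' => hz.not_gt h'.2⟩, hb.trans hz, hd⟩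

end PointInterval

/-! ### Incomplete sets. -/

namespace PointInterval
open Formula

variable {C : OrderClass.{u}} {S : Set Rel}

theorem isComplete_of_dual (hC : C.Admissible) (h : IsComplete C RPlus (Rel.dual ⁻¹' S)) :
    IsComplete C RPlus S := by
  intro r hr
  have := (defines_dual_iff hC.dual).1 (h r.dual hr)
  rwa [Rel.dual_dual] at this

theorem den_uLift (D : Type) [LinearOrder D] [DenselyOrdered D] :
    Den (ULift.{u} D) inferInstance := fun a b hab => by
  obtain ⟨c, h₁, h₂⟩ := exists_between (show a.down < b.down from hab)
  exact ⟨⟨c⟩, h₁, h₂⟩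

theorem unb_uLift (D : Type) [LinearOrder D] [NoMaxOrder D] [NoMinOrder D] :
    Unb (ULift.{u} D) inferInstance := fun a => by
  obtain ⟨b, hb⟩ := exists_gt a.down
  obtain ⟨c, hc⟩ := exists_lt a.down
  exact ⟨⟨⟨b⟩, hb⟩, ⟨c⟩, hc⟩

theorem not_isComplete_of_preserves {D : Type} [LinearOrder D]
    (hD : C (ULift.{u} D) inferInstance) {f : D → D} {g : Ivl D → Ivl D}
    (hf : Function.Surjective f) (hg : Function.Surjective g)
    (h : ∀ r ∈ S, Preserves f g r) {r : Rel} (hr : ¬ Preserves f g r) : ¬ IsComplete C RPlus S :=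
  fun hS => hr (preserves_of_defines hD hf hg h (hS r trivial))

/-- These relations see right endpoints only by comparing intervals with a common left endpoint.
Doubling the right endpoints of the intervals that start at 0 preserves that comparison and breaks
`ip3`. -/
theorem not_isComplete_ip0_ip1 (hD : C (ULift.{u} ℚ) inferInstance) :
    ¬ IsComplete C RPlus {Rel.ip0, Rel.ip1, Rel.ii14, Rel.lt, Rel.eqi, Rel.eqp} := by
  let g : Ivl ℚ → Ivl ℚ := fun I => ⟨I.lo, if I.lo = 0 then 2 * I.hi else I.hi, by
    have := I.lo_lt_hi
    split_ifs <;> linarith⟩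
  refine not_isComplete_of_preserves hD (f := id) (g := g) Function.surjective_id ?_ ?_
    (r := .ip3) ?_
  · intro I
    refine ⟨⟨I.lo, if I.lo = 0 then I.hi / 2 else I.hi, ?_⟩, ?_⟩
    · have := I.lo_lt_hi
      split_ifs <;> linarith
    · refine Ivl.ext' rfl ?_
      by_cases h : I.lo = 0
      · simp [g, h, mul_div_cancel₀]
      · simp [g, h]
  · simp only [Set.mem_insert_iff, Set.mem_singleton_iff]
    rintro r (rfl | rfl | rfl | rfl | rfl | rfl) x y
    · exact Iff.rfl
    · exact Iff.rfl
    · refine and_congr_right fun h => ?_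
      replace h : x.lo = y.lo := h
      by_cases hy : y.lo = 0 <;> simp [g, h, hy]
    · exact Iff.rfl
    · simp only [IRel.Holds, Ivl.eq_iff]
      refine and_congr_right fun h => ?_
      replace h : x.lo = y.lo := h
      by_cases hy : y.lo = 0 <;> simp [g, h, hy]
    · exact Iff.rfl
  · intro h
    have := h ⟨0, 1, one_pos⟩ 1
    simp [MRel.Holds, g] at this

theorem not_isComplete_ip3_ip4 (hC : C.Admissible) (hD : C (ULift.{u} ℚ) inferInstance) :
    ¬ IsComplete C RPlus {Rel.ip3, Rel.ip4, Rel.ii03, Rel.lt, Rel.eqi, Rel.eqp} := by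
  intro h
  refine not_isComplete_ip0_ip1 hD (isComplete_of_dual hC fun r hr => (h r hr).mono ?_)
  simp [Set.insert_subset_iff, Rel.dual, MRel.dual, IRel.dual]

/-- No relation here links the two sorts, so the points can be translated while the intervals stay
fixed. -/
theorem not_isComplete_ii_lt (hD : C (ULift.{u} ℚ) inferInstance) :
    ¬ IsComplete C RPlus {Rel.ii03, Rel.ii04, Rel.ii14, Rel.ii24, Rel.ii34, Rel.ii44, Rel.lt,
      Rel.eqi, Rel.eqp} := by
  refine not_isComplete_of_preserves hD (f := fun x => x + 1) (g := id)
    (fun x => ⟨x - 1, sub_add_cancel x 1⟩) Function.surjective_id ?_ (r := .ip1) ?_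
  · simp only [Set.mem_insert_iff, Set.mem_singleton_iff]
    rintro r (rfl | rfl | rfl | rfl | rfl | rfl | rfl | rfl | rfl) x y <;>
      simp [PRel.Holds]
  · intro h
    have := h ⟨0, 1, one_pos⟩ 0
    simp [MRel.Holds] at this

/-- In ℚ ∩ [0, 1] the points 0 and 1 are interior to no interval, so they can be exchanged. -/
theorem not_isComplete_den_ip2_ii :
    ¬ IsComplete Den.{u} RPlus {Rel.ip2, Rel.ii03, Rel.ii04, Rel.ii14, Rel.ii24, Rel.ii34,
      Rel.ii44, Rel.eqi, Rel.eqp} := by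
  refine not_isComplete_of_preserves (den_uLift (Set.Icc (0 : ℚ) 1))
    (f := Equiv.swap (0 : Set.Icc (0 : ℚ) 1) 1) (g := id)
    (Equiv.surjective _) Function.surjective_id ?_ (r := .lt) ?_
  · simp only [Set.mem_insert_iff, Set.mem_singleton_iff]
    rintro r (rfl | rfl | rfl | rfl | rfl | rfl | rfl | rfl | rfl) x y
    · have h₀ : ∀ I : Ivl (Set.Icc (0 : ℚ) 1), ¬ MRel.reg2.Holds I 0 := fun I h =>
        not_lt.2 I.lo.2.1 h.1
      have h₁ : ∀ I : Ivl (Set.Icc (0 : ℚ) 1), ¬ MRel.reg2.Holds I 1 := fun I h =>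
        not_lt.2 I.hi.2.2 h.2
      by_cases hy₀ : y = 0
      · simp [hy₀, h₀, h₁]
      by_cases hy₁ : y = 1
      · simp [hy₁, h₀, h₁]
      · rw [Equiv.swap_apply_of_ne_of_ne hy₀ hy₁]
        rfl
    all_goals simp [PRel.Holds]
  · intro h
    have := h 0 1
    simp only [PRel.Holds, Equiv.swap_apply_left, Equiv.swap_apply_right] at this
    have h01 : (0 : Set.Icc (0 : ℚ) 1) < 1 := Subtype.mk_lt_mk.2 one_pos
    exact lt_asymm h01 (this.2 h01)

/-- Shift the intervals of length one in the integers. -/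
def shiftUnit (k : ℤ) (I : Ivl ℤ) : Ivl ℤ :=
  if h : I.hi = I.lo + 1 then ⟨I.lo + k, I.hi + k, by omega⟩ else I

theorem shiftUnit_shiftUnit (k : ℤ) (I : Ivl ℤ) : shiftUnit k (shiftUnit (-k) I) = I := by
  by_cases h : I.hi = I.lo + 1
  · have : I.hi + -k = I.lo + -k + 1 := by omega
    simp [shiftUnit, h, add_right_comm]
    exact Ivl.ext' rfl h.symm
  · simp [shiftUnit, h]

/-- In ℤ the unit intervals have no interior points and overlap nothing, in either argument, so they
can be shifted among themselves. -/
theorem not_isComplete_unb_ip2_overlaps :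
    ¬ IsComplete Unb.{u} RPlus {Rel.ip2, Rel.ii24, Rel.lt, Rel.eqi, Rel.eqp} := by
  refine not_isComplete_of_preserves (unb_uLift ℤ) (f := id) (g := shiftUnit 1)
    Function.surjective_id (fun I => ⟨_, shiftUnit_shiftUnit 1 I⟩) ?_ (r := .ip1) ?_
  · simp only [Set.mem_insert_iff, Set.mem_singleton_iff]
    rintro r (rfl | rfl | rfl | rfl | rfl) x y
    · by_cases h : x.hi = x.lo + 1 <;> simp [MRel.Holds, shiftUnit, h]
      constructor <;> intro <;> omega
    · by_cases h : x.hi = x.lo + 1 <;> by_cases h' : y.hi = y.lo + 1 <;>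
        simp [IRel.Holds, shiftUnit, h, h']
      all_goals constructor <;> intro <;> omega
    · exact Iff.rfl
    · have : Function.Injective (shiftUnit 1) := Function.LeftInverse.injective
        (g := shiftUnit (-1)) fun I => by simpa using shiftUnit_shiftUnit (-1) I
      exact this.eq_iff
    · exact Iff.rfl
  · intro h
    have := h ⟨0, 1, one_pos⟩ 0
    simp [MRel.Holds, shiftUnit] at this

/-- These relations are invariant under the reflection of ℤ. -/
theorem not_isComplete_unb_ip2_during :
    ¬ IsComplete Unb.{u} RPlus {Rel.ip2, Rel.ii04, Rel.eqi, Rel.eqp} := by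
  let g : Ivl ℤ → Ivl ℤ := fun I => ⟨-I.hi, -I.lo, neg_lt_neg I.lo_lt_hi⟩
  refine not_isComplete_of_preserves (unb_uLift ℤ) (f := fun x => -x) (g := g)
    neg_surjective (fun I => ⟨g I, by simp [g]⟩) ?_ (r := .lt) ?_
  · simp only [Set.mem_insert_iff, Set.mem_singleton_iff]
    rintro r (rfl | rfl | rfl | rfl) x y <;>
      simp [MRel.Holds, IRel.Holds, PRel.Holds, g, Ivl.eq_iff, and_comm]
  · intro h
    have := h 0 1
    simp [PRel.Holds] at this

end PointInterval

/-! ### Assembling the classification. -/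

namespace PointInterval

variable {C : OrderClass.{u}} {S : Set Rel}

theorem IsComplete.mono {T : Set Rel} (h : S ⊆ T) (hS : IsComplete C RPlus S) :
    IsComplete C RPlus T := fun r hr => (hS r hr).mono h

theorem isIncomplete_iff : IsIncomplete C RPlus S ↔ ¬ IsComplete C RPlus S := by
  simp [IsIncomplete, IsComplete]

/-- If `M` consists of complete sets, `N` is an antichain of incomplete sets, every set lies
above a member of `M` or below a member of `N`, and removing any element from a member of `M` leads
below a member of `N`, then `M` consists of the minimally complete sets and `N` of the maximally
incomplete ones. -/
theorem isMinimallyComplete_iff_and_isMaximallyIncomplete_iff {M N : Set (Set Rel)}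
    (hM : ∀ m ∈ M, IsComplete C RPlus m) (hN : ∀ n ∈ N, ¬ IsComplete C RPlus n)
    (hMN : ∀ S : Set Rel, (∃ m ∈ M, m ⊆ S) ∨ ∃ n ∈ N, S ⊆ n)
    (hM' : ∀ m ∈ M, ∀ r ∈ m, ∃ n ∈ N, m \ {r} ⊆ n)
    (hN' : ∀ n ∈ N, ∀ n' ∈ N, n ⊆ n' → n = n') :
    (∀ S, IsMinimallyComplete C RPlus S ↔ S ∈ M) ∧
      ∀ S, IsMaximallyIncomplete C RPlus S ↔ S ∈ N := by
  simp only [IsMinimallyComplete, IsMaximallyIncomplete, isIncomplete_iff]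
  refine ⟨fun S => ⟨fun ⟨h₁, h₂⟩ => ?_, fun h => ⟨hM S h, fun T hT hc => ?_⟩⟩,
    fun S => ⟨fun ⟨h₁, h₂⟩ => ?_, fun h => ⟨hN S h, fun T hT => ?_⟩⟩⟩
  · rcases hMN S with ⟨m, hm, hmS⟩ | ⟨n, hn, hSn⟩
    · rcases hmS.eq_or_ssubset with rfl | hlt
      · exact hm
      · exact (h₂ m hlt (hM m hm)).elim
    · exact (hN n hn (h₁.mono hSn)).elim
  · obtain ⟨hTS, r, hr, hrT⟩ := Set.ssubset_iff_exists.1 hT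
    obtain ⟨n, hn, hSn⟩ := hM' S h r hr
    exact hN n hn (hc.mono ((Set.subset_sdiff_singleton hTS hrT).trans hSn))
  · rcases hMN S with ⟨m, hm, hmS⟩ | ⟨n, hn, hSn⟩
    · exact (h₁ ((hM m hm).mono hmS)).elim
    · rcases hSn.eq_or_ssubset with rfl | hlt
      · exact hn
      · exact (hN n hn (h₂ n hlt)).elim
  · rcases hMN T with ⟨m, hm, hmT⟩ | ⟨n, hn, hTn⟩
    · exact (hM m hm).mono hmT
    · have := hN' S h n hn (hT.subset.trans hTn)
      subst this
      exact (hT.not_subset hTn).elim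

/-- The case of `ii04` is the only one argued differently over the two classes, so it enters as the
hypothesis `hd`. -/
theorem isComplete_of_ip1 (hC : C.Admissible)
    (hd : Defines C S .ip1 → Defines C S .ii04 → IsComplete C RPlus S) (h1 : Defines C S .ip1)
    (h : ∃ r ∈ S, r = .ip2 ∨ r = .ip3 ∨ r = .ip4 ∨ r = .ii24 ∨ r = .ii03 ∨ r = .ii34 ∨ r = .ii04 ∨
      r = .ii44) : IsComplete C RPlus S := by
  obtain ⟨r, hr, rfl | rfl | rfl | rfl | rfl | rfl | rfl | rfl⟩ := h
  · exact isComplete_of_ip1_ip2 h1 (.of_mem hr)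
  · exact isComplete_of_ip1_ip3 h1 (.of_mem hr)
  · exact isComplete_of_ip1_ip4 hC h1 (.of_mem hr)
  · exact isComplete_of_ip1_overlaps hC h1 (.of_mem hr)
  · exact isComplete_of_ip1_finishes h1 (.of_mem hr)
  · exact isComplete_of_ip1_meets h1 (.of_mem hr)
  · exact hd h1 (.of_mem hr)
  · exact isComplete_of_ip1_before hC h1 (.of_mem hr)

theorem isComplete_of_ip0_or_ip1 (hC : C.Admissible)
    (hd : Defines C S .ip1 → Defines C S .ii04 → IsComplete C RPlus S)
    (h1 : Rel.ip0 ∈ S ∨ Rel.ip1 ∈ S)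
    (h : ∃ r ∈ S, r = .ip2 ∨ r = .ip3 ∨ r = .ip4 ∨ r = .ii24 ∨ r = .ii03 ∨ r = .ii34 ∨ r = .ii04 ∨
      r = .ii44) : IsComplete C RPlus S :=
  isComplete_of_ip1 hC hd (h1.elim (fun h => defines_ip1_of_ip0 hC (.of_mem h)) .of_mem) h

theorem isComplete_of_ip3_or_ip4 (hC : C.Admissible)
    (hd : ∀ S, Defines C S .ip1 → Defines C S .ii04 → IsComplete C RPlus S)
    (h1 : Rel.ip4 ∈ S ∨ Rel.ip3 ∈ S)
    (h : ∃ r ∈ S, r = .ip2 ∨ r = .ii14 ∨ r = .ii24 ∨ r = .ii34 ∨ r = .ii04 ∨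
      r = .ii44) : IsComplete C RPlus S := by
  -- Here `hd` is needed for the dual of S, and `h1` is by unfolding the statement that this dual
  -- contains `ip0` or `ip1`.
  refine isComplete_of_dual hC (isComplete_of_ip0_or_ip1 hC (hd _) h1 ?_)
  obtain ⟨r, hr, h⟩ := h
  refine ⟨r.dual, Rel.mem_preimage_dual hr, ?_⟩
  rcases h with rfl | rfl | rfl | rfl | rfl | rfl <;> simp [Rel.dual, MRel.dual, IRel.dual]

theorem isComplete_of_mem_denMcs : ∀ m ∈ denMcs, IsComplete Den.{u} RPlus m := by
  intro m hm
  simp only [denMcs, Set.mem_insert_iff, Set.mem_singleton_iff] at hm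
  have hd := fun S => isComplete_den_of_ip1_during.{u} (S := S)
  rcases hm with rfl | rfl | rfl | rfl | rfl | rfl | rfl | rfl | rfl | rfl | rfl | rfl | rfl | rfl |
    rfl | rfl | rfl | rfl | rfl | rfl | rfl | rfl | rfl | rfl | rfl | rfl | rfl | rfl | rfl
  all_goals first
    | (refine isComplete_of_ip0_or_ip1 den_admissible (hd _) ?_ ?_ <;> simp; done)
    | (refine isComplete_of_ip3_or_ip4 den_admissible hd ?_ ?_ <;> simp; done)
    | (refine isComplete_den_of_ip2_lt (.of_mem ?_) (.of_mem ?_) <;> simp)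

theorem isComplete_unb_of_ip2_finishes (h2 : Rel.ip2 ∈ S) (h : Rel.ii03 ∈ S) :
    IsComplete Unb.{u} RPlus S :=
  isComplete_of_dual unb_admissible (isComplete_unb_of_ip2_starts (.of_mem h2) (.of_mem h))

theorem isComplete_of_mem_unbMcs : ∀ m ∈ unbMcs, IsComplete Unb.{u} RPlus m := by
  intro m hm
  simp only [unbMcs, Set.mem_insert_iff, Set.mem_singleton_iff] at hm
  have hd := fun S => isComplete_unb_of_ip1_during.{u} (S := S)
  rcases hm with rfl | rfl | rfl | rfl | rfl | rfl | rfl | rfl | rfl | rfl | rfl | rfl | rfl | rfl |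
    rfl | rfl | rfl | rfl | rfl | rfl | rfl | rfl | rfl | rfl | rfl | rfl | rfl | rfl | rfl | rfl |
    rfl | rfl | rfl | rfl
  all_goals first
    | (refine isComplete_of_ip0_or_ip1 unb_admissible (hd _) ?_ ?_ <;> simp; done)
    | (refine isComplete_of_ip3_or_ip4 unb_admissible hd ?_ ?_ <;> simp; done)
    | (refine isComplete_unb_of_ip2_starts (.of_mem ?_) (.of_mem ?_) <;> simp; done)
    | (refine isComplete_unb_of_ip2_finishes ?_ ?_ <;> simp; done)
    | (refine isComplete_unb_of_ip2_meets (.of_mem ?_) (.of_mem ?_) <;> simp; done)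
    | (refine isComplete_unb_of_ip2_before (.of_mem ?_) (.of_mem ?_) <;> simp; done)
    | (refine isComplete_unb_of_ip2_during_lt (.of_mem ?_) (.of_mem ?_)
        (.of_mem ?_) <;> simp; done)
    | (refine isComplete_unb_of_ip2_during_overlaps (.of_mem ?_) (.of_mem ?_)
        (.of_mem ?_) <;> simp)

theorem not_isComplete_of_mem_denMIS : ∀ n ∈ denMIS, ¬ IsComplete Den.{u} RPlus n := by
  intro n hn
  simp only [denMIS, Set.mem_insert_iff, Set.mem_singleton_iff] at hn
  rcases hn with rfl | rfl | rfl | rfl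
  · exact not_isComplete_ip0_ip1 (den_uLift ℚ)
  · exact not_isComplete_den_ip2_ii
  · exact not_isComplete_ip3_ip4 den_admissible (den_uLift ℚ)
  · exact not_isComplete_ii_lt (den_uLift ℚ)

theorem not_isComplete_of_mem_unbMIS : ∀ n ∈ unbMIS, ¬ IsComplete Unb.{u} RPlus n := by
  intro n hn
  simp only [unbMIS, Set.mem_insert_iff, Set.mem_singleton_iff] at hn
  rcases hn with rfl | rfl | rfl | rfl | rfl
  · exact not_isComplete_ip0_ip1 (unb_uLift ℚ)
  · exact not_isComplete_unb_ip2_overlaps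
  · exact not_isComplete_unb_ip2_during
  · exact not_isComplete_ip3_ip4 unb_admissible (unb_uLift ℚ)
  · exact not_isComplete_ii_lt (unb_uLift ℚ)

/-- Turns inclusions into propositional formulas in fourteen membership statements, so that the
covering claims below become finite propositional problems. -/
theorem subset_iff_forall {S T : Set Rel} : S ⊆ T ↔
    ((.lt ∈ S → .lt ∈ T) ∧ (.eqp ∈ S → .eqp ∈ T)) ∧
    ((.ip0 ∈ S → .ip0 ∈ T) ∧ (.ip1 ∈ S → .ip1 ∈ T) ∧ (.ip2 ∈ S → .ip2 ∈ T) ∧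
      (.ip3 ∈ S → .ip3 ∈ T) ∧ (.ip4 ∈ S → .ip4 ∈ T)) ∧
    (.eqi ∈ S → .eqi ∈ T) ∧ (.ii34 ∈ S → .ii34 ∈ T) ∧ (.ii14 ∈ S → .ii14 ∈ T) ∧
      (.ii03 ∈ S → .ii03 ∈ T) ∧ (.ii04 ∈ S → .ii04 ∈ T) ∧ (.ii24 ∈ S → .ii24 ∈ T) ∧
      (.ii44 ∈ S → .ii44 ∈ T) := by
  refine ⟨fun h => ⟨⟨@h _, @h _⟩, ⟨@h _, @h _, @h _, @h _, @h _⟩, @h _, @h _, @h _, @h _, @h _,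
    @h _, @h _⟩, ?_⟩
  rintro ⟨⟨h₁, h₂⟩, ⟨h₃, h₄, h₅, h₆, h₇⟩, h₈, h₉, h₁₀, h₁₁, h₁₂, h₁₃, h₁₄⟩ (r | r | r) hr <;> cases r
  exacts [h₁ hr, h₂ hr, h₃ hr, h₄ hr, h₅ hr, h₆ hr, h₇ hr, h₈ hr, h₉ hr, h₁₀ hr, h₁₁ hr, h₁₂ hr,
    h₁₃ hr, h₁₄ hr]

theorem exists_denMcs_subset_or (S : Set Rel) :
    (∃ m ∈ denMcs, m ⊆ S) ∨ ∃ n ∈ denMIS, S ⊆ n := by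
  simp only [denMcs, denMIS, Set.exists_mem_insert, Set.mem_singleton_iff, exists_eq_left,
    Set.insert_subset_iff, Set.singleton_subset_iff]
  simp only [subset_iff_forall, Set.mem_insert_iff, Set.mem_singleton_iff, reduceCtorEq,
    Rel.pp.injEq, Rel.ip.injEq, Rel.ii.injEq, or_false, or_true, imp_true_iff, imp_false,
    and_true, true_and]
  grind

theorem exists_unbMcs_subset_or (S : Set Rel) :
    (∃ m ∈ unbMcs, m ⊆ S) ∨ ∃ n ∈ unbMIS, S ⊆ n := by
  simp only [unbMcs, unbMIS, Set.exists_mem_insert, Set.mem_singleton_iff, exists_eq_left,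
    Set.insert_subset_iff, Set.singleton_subset_iff]
  simp only [subset_iff_forall, Set.mem_insert_iff, Set.mem_singleton_iff, reduceCtorEq,
    Rel.pp.injEq, Rel.ip.injEq, Rel.ii.injEq, or_false, or_true, imp_true_iff, imp_false,
    and_true, true_and]
  grind

theorem exists_denMIS_diff_subset : ∀ m ∈ denMcs, ∀ r ∈ m, ∃ n ∈ denMIS, m \ {r} ⊆ n := by
  simp only [denMcs, denMIS, Set.forall_mem_insert, Set.exists_mem_insert, Set.mem_singleton_iff,
    exists_eq_left, forall_eq]
  simp only [Set.sdiff_singleton_subset_iff, Set.insert_subset_iff,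
    Set.singleton_subset_iff, Set.mem_insert_iff, reduceCtorEq,
    Rel.ip.injEq, Rel.ii.injEq, false_or, or_true, true_or, and_true, and_self]

theorem exists_unbMIS_diff_subset : ∀ m ∈ unbMcs, ∀ r ∈ m, ∃ n ∈ unbMIS, m \ {r} ⊆ n := by
  simp only [unbMcs, unbMIS, Set.forall_mem_insert, Set.exists_mem_insert, Set.mem_singleton_iff,
    exists_eq_left, forall_eq]
  simp only [Set.sdiff_singleton_subset_iff, Set.insert_subset_iff,
    Set.singleton_subset_iff, Set.mem_insert_iff, reduceCtorEq,
    Rel.ip.injEq, Rel.ii.injEq, false_or, or_true, true_or, and_true, and_self]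

theorem denMIS_antichain : ∀ n ∈ denMIS, ∀ n' ∈ denMIS, n ⊆ n' → n = n' := by
  intro n hn n' hn'
  simp only [denMIS, Set.mem_insert_iff, Set.mem_singleton_iff] at hn hn'
  rcases hn with rfl | rfl | rfl | rfl <;> rcases hn' with rfl | rfl | rfl | rfl <;>
    simp [Set.insert_subset_iff]

theorem unbMIS_antichain : ∀ n ∈ unbMIS, ∀ n' ∈ unbMIS, n ⊆ n' → n = n' := by
  intro n hn n' hn'
  simp only [unbMIS, Set.mem_insert_iff, Set.mem_singleton_iff] at hn hn'
  rcases hn with rfl | rfl | rfl | rfl | rfl <;> rcases hn' with rfl | rfl | rfl | rfl | rfl <;>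
    simp [Set.insert_subset_iff]

end PointInterval

theorem mainTheorem1 :
    ((∀ S : Set PointInterval.Rel,
        PointInterval.IsMinimallyComplete PointInterval.Den.{u} PointInterval.RPlus S ↔
          S ∈ PointInterval.denMcs) ∧
      (∀ S : Set PointInterval.Rel,
        PointInterval.IsMaximallyIncomplete PointInterval.Den.{u} PointInterval.RPlus S ↔
          S ∈ PointInterval.denMIS)) ∧
    ((∀ S : Set PointInterval.Rel,
        PointInterval.IsMinimallyComplete PointInterval.Unb.{u} PointInterval.RPlus S ↔
          S ∈ PointInterval.unbMcs) ∧
      (∀ S : Set PointInterval.Rel,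
        PointInterval.IsMaximallyIncomplete PointInterval.Unb.{u} PointInterval.RPlus S ↔
          S ∈ PointInterval.unbMIS)) :=
  ⟨PointInterval.isMinimallyComplete_iff_and_isMaximallyIncomplete_iff
      PointInterval.isComplete_of_mem_denMcs PointInterval.not_isComplete_of_mem_denMIS
      PointInterval.exists_denMcs_subset_or PointInterval.exists_denMIS_diff_subset
      PointInterval.denMIS_antichain,
    PointInterval.isMinimallyComplete_iff_and_isMaximallyIncomplete_iff
      PointInterval.isComplete_of_mem_unbMcs PointInterval.not_isComplete_of_mem_unbMIS
      PointInterval.exists_unbMcs_subset_or PointInterval.exists_unbMIS_diff_subset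
      PointInterval.unbMIS_antichain⟩
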